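/- Let $\mathcal{SF}$ be the category of symmetric forests: its objects are $1,2,3,\dots$, a morphism from $n$ to $m$ is a pair $(p,\sigma)$ of a finite ordered rooted binary forest $p$ with $n$ roots and $m$ leaves and a permutation $\sigma\in S_m$ of its leaves, and composition is vertical stacking of diagrams. Thompson's group $V$ is its group of fractions at the object $1$: its elements are the classes $\frac ts$ of pairs of morphisms $t,s$ with source $1$ and a common target, modulo the equivalence relation generated by $(t,s)\sim(ft,fs)$, with product $\frac ts\cdot\frac{t'}{s'}=\frac{ft}{f's'}$ whenever $fs=f't'$. Let $M$ be the free monoid on letters $a_0,b_0,a_1,b_1,\dots$ with empty word $e$, let $M_j\subset M$ be the submonoid generated by $a_i,b_i$, $0\le i\le j$, and $M_{-1}=\{e\}$. Let $(\delta_x)_{x\in M}$ be the standard basis of $\mathfrak H=\ell^2(M)$, and identify $\mathfrak H^{\otimes n}$ with $\ell^2(M^n)$. For $0\le\alpha\le1$ and $\beta=\sqrt{1-\alpha^2}$ let $R_\alpha:\mathfrak H\to\mathfrak H\otimes\mathfrak H$ be the isometry with $$R_\alpha\delta_e=\alpha\,\delta_{e,e}+\beta\,\delta_{a_0,b_0},\qquad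 R_\alpha\delta_x=\alpha\,\delta_{xa_j,xb_j}+\beta\,\delta_{xa_{j+1},xb_{j+1}}\quad\text{if } e\ne x\in M_j\setminus M_{j-1},\ j\ge0 .$$ Let $\Phi_\alpha$ be the monoidal functor from $\mathcal{SF}$ to Hilbert spaces with isometries such that $\Phi_\alpha(1)=\mathfrak H$, $\Phi_\alpha$ sends the tree with two leaves to $R_\alpha$, and permutations act by permuting tensor factors. Let $\mathscr H_\alpha$ be the completion of the inductive limit of the spaces $\Phi_\alpha(n)$ over all morphisms $r:1\to n$ of $\mathcal{SF}$, ordered by $r\le fr$, with connecting maps $\Phi_\alpha(f)$; write $\frac rx$ for the class of $x\in\Phi_\alpha(n)$ at $r$. Let $\pi_\alpha:V\to\mathcal U(\mathscr H_\alpha)$ be the Jones representation, $\pi_\alpha(\frac ts)\frac rx=\frac{pt}{\Phi_\alpha(q)x}$ for $ps=qr$. Regard $\delta_e\in\mathfrak H=\Phi_\alpha(1)$ as the vector $\frac{\mathrm{id}}{\delta_e}$ of $\mathscr H_\alpha$ and put $\phi_\alpha(v)=\langle\pi_\alpha(v)\delta_e,\delta_e\rangle$ for $v\in V$. Then: 1.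 For every $0<\alpha<1$ the function $\phi_\alpha:V\to\mathbf C$ is positive definite and vanishes at infinity, i.e. for every $\varepsilon>0$ one has $|\phi_\alpha(v)|<\varepsilon$ for all but finitely many $v\in V$. 2. $\lim_{\alpha\to1,\ \alpha<1}\phi_\alpha(v)=1$ for every $v\in V$. 3. Consequently the discrete group $V$ has the Haagerup property: there is a net of positive definite functions on $V$ that vanish at infinity and converge pointwise to one. -/

import Mathlib

open CategoryTheory Filter Topology
open scoped ComplexOrder ComplexConjugate

noncomputable section

namespace Jones

/-- A small category `C` admits a calculus of left fractions: the left Ore condition and weak left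
cancellation hold at every object. (`f ≫ g` is first `f`, then `g`.) -/
class LeftCalculus (C : Type) [Category.{0} C] : Prop where
  ore : ∀ {e a b : C} (p : e ⟶ a) (q : e ⟶ b),
    ∃ (c : C) (h : a ⟶ c) (k : b ⟶ c), p ≫ h = q ≫ k
  cancel : ∀ {a e b : C} (f : a ⟶ e) (p q : e ⟶ b), f ≫ p = f ≫ q →
    ∃ (c : C) (g : b ⟶ c), p ≫ g = q ≫ g

section Fractions

variable {C : Type} [Category.{0} C]

/-- A pair `(t, s)` of morphisms with source `e` and a common target. -/
structure FractionPair (e : C) where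
  tgt : C
  num : e ⟶ tgt
  den : e ⟶ tgt

/-- `(t, s) ∼ (ft, fs)`. -/
def FractionPair.Extends {e : C} (x y : FractionPair e) : Prop :=
  ∃ f : x.tgt ⟶ y.tgt, y.num = x.num ≫ f ∧ y.den = x.den ≫ f

/-- The set of fractions `t / s`: pairs `(t, s)` modulo the equivalence relation generated by
`(t, s) ∼ (ft, fs)`. -/
def FractionGroup (e : C) : Type := Quot (FractionPair.Extends (e := e))

namespace FractionGroup

/-- The fraction `t / s`. -/
def mk {e b : C} (t s : e ⟶ b) : FractionGroup e := Quot.mk _ ⟨b, t, s⟩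

theorem mk_comp {e b c : C} (t s : e ⟶ b) (f : b ⟶ c) : mk (t ≫ f) (s ≫ f) = mk t s :=
  (Quot.sound ⟨f, rfl, rfl⟩ : (Quot.mk _ ⟨b, t, s⟩ : FractionGroup e) = Quot.mk _ _).symm

theorem ind {e : C} {P : FractionGroup e → Prop} (h : ∀ (b : C) (t s : e ⟶ b), P (mk t s))
    (v : FractionGroup e) : P v :=
  Quot.ind (fun x => h x.tgt x.num x.den) v

instance (e : C) : One (FractionGroup e) := ⟨mk (𝟙 e) (𝟙 e)⟩

theorem mk_self {e b : C} (t : e ⟶ b) : mk t t = 1 := by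
  rw [show (1 : FractionGroup e) = mk (𝟙 e) (𝟙 e) from rfl, ← mk_comp (𝟙 e) (𝟙 e) t,
    Category.id_comp]

instance (e : C) : Inv (FractionGroup e) where
  inv := Quot.map (fun x => ⟨x.tgt, x.den, x.num⟩) (fun _ _ ⟨f, h₁, h₂⟩ => ⟨f, h₂, h₁⟩)

theorem inv_mk {e b : C} (t s : e ⟶ b) : (mk t s)⁻¹ = mk s t := rfl

variable [LeftCalculus C]

/-- The product `(t / s)(t' / s') = ft / f's'`, where `fs = f't'`. -/
def mulPair {e : C} (x y : FractionPair e) : FractionGroup e :=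
  let h := LeftCalculus.ore x.den y.num
  mk (x.num ≫ h.choose_spec.choose) (y.den ≫ h.choose_spec.choose_spec.choose)

theorem mk_eq_mk_of_ore {e a b c d : C} (t s : e ⟶ a) (t' s' : e ⟶ b)
    (f : a ⟶ c) (f' : b ⟶ c) (hf : s ≫ f = t' ≫ f')
    (g : a ⟶ d) (g' : b ⟶ d) (hg : s ≫ g = t' ≫ g') :
    mk (t ≫ f) (s' ≫ f') = mk (t ≫ g) (s' ≫ g') := by
  obtain ⟨_, h, k, hk⟩ := LeftCalculus.ore (s ≫ f) (s ≫ g)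
  simp only [Category.assoc] at hk
  obtain ⟨_, u, hu⟩ := LeftCalculus.cancel s (f ≫ h) (g ≫ k) hk
  have hk' : t' ≫ f' ≫ h ≫ u = t' ≫ g' ≫ k ≫ u := by
    rw [← reassoc_of% hf, ← reassoc_of% hg]
    simpa using congrArg (s ≫ ·) hu
  obtain ⟨_, w, hw⟩ := LeftCalculus.cancel t' (f' ≫ h ≫ u) (g' ≫ k ≫ u) hk'
  rw [← mk_comp (t ≫ f) (s' ≫ f') (h ≫ u ≫ w), ← mk_comp (t ≫ g) (s' ≫ g') (k ≫ u ≫ w)]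
  congr 1
  · simpa using congrArg (fun z => t ≫ z ≫ w) hu
  · simpa using congrArg (fun z => s' ≫ z) hw

theorem mulPair_eq {e : C} (x y : FractionPair e) {c : C} (f : x.tgt ⟶ c) (f' : y.tgt ⟶ c)
    (h : x.den ≫ f = y.num ≫ f') : mulPair x y = mk (x.num ≫ f) (y.den ≫ f') :=
  mk_eq_mk_of_ore _ _ _ _ _ _ (LeftCalculus.ore x.den y.num).choose_spec.choose_spec.choose_spec
    _ _ h

instance (e : C) : Mul (FractionGroup e) where
  mul := Quot.lift₂ mulPair
    (by
      rintro ⟨_, t, s⟩ ⟨_, t', s'⟩ ⟨_, t'', s''⟩ ⟨g, h₁, h₂⟩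
      dsimp only at g h₁ h₂
      subst h₁ h₂
      obtain ⟨_, f, f', hf⟩ := LeftCalculus.ore s (t' ≫ g)
      rw [mulPair_eq ⟨_, t, s⟩ ⟨_, t' ≫ g, s' ≫ g⟩ f f' hf,
        mulPair_eq ⟨_, t, s⟩ ⟨_, t', s'⟩ f (g ≫ f') (by simpa using hf)]
      simp)
    (by
      rintro ⟨_, t, s⟩ ⟨_, t', s'⟩ ⟨_, t'', s''⟩ ⟨g, h₁, h₂⟩
      dsimp only at g h₁ h₂
      subst h₁ h₂
      obtain ⟨_, f, f', hf⟩ := LeftCalculus.ore (s ≫ g) t''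
      rw [mulPair_eq ⟨_, t ≫ g, s ≫ g⟩ ⟨_, t'', s''⟩ f f' hf,
        mulPair_eq ⟨_, t, s⟩ ⟨_, t'', s''⟩ (g ≫ f) f' (by simpa using hf)]
      simp)

/-- The product rule for fractions, for any choice of `f`, `f'` with `fs = f't'`. -/
theorem mk_mul_mk {e a b c : C} (t s : e ⟶ a) (t' s' : e ⟶ b) (f : a ⟶ c) (f' : b ⟶ c)
    (h : s ≫ f = t' ≫ f') : mk t s * mk t' s' = mk (t ≫ f) (s' ≫ f') :=
  mulPair_eq ⟨a, t, s⟩ ⟨b, t', s'⟩ f f' h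

instance (e : C) : Group (FractionGroup e) :=
  Group.ofLeftAxioms
    (by
      intro x y z
      induction x using ind with | h a t s =>
      induction y using ind with | h b t' s' =>
      induction z using ind with | h c t'' s'' =>
      obtain ⟨_, f, f', hf⟩ := LeftCalculus.ore s t'
      obtain ⟨_, g, g', hg⟩ := LeftCalculus.ore (s' ≫ f') t''
      simp only [Category.assoc] at hg
      rw [mk_mul_mk t s t' s' f f' hf, mk_mul_mk _ _ t'' s'' g g' (by simpa using hg),
        mk_mul_mk t' s' t'' s'' (f' ≫ g) g' hg,
        mk_mul_mk t s _ _ (f ≫ g) (𝟙 _) (by simp [reassoc_of% hf])]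
      simp)
    (by
      intro x
      induction x using ind with | h a t s =>
      rw [← mk_self t, mk_mul_mk t t t s (𝟙 _) (𝟙 _) rfl]
      simp)
    (by
      intro x
      induction x using ind with | h a t s =>
      rw [inv_mk, mk_mul_mk s t t s (𝟙 _) (𝟙 _) rfl, mk_self])

end FractionGroup
end Fractions

section JonesAction

/-- A functor from `C` to the category of complex Hilbert spaces with isometries. -/
structure HilbFunctor (C : Type) [Category.{0} C] where
  space : C → Type
  [normed : ∀ a, NormedAddCommGroup (space a)]
  [innerProduct : ∀ a, InnerProductSpace ℂ (space a)]
  [complete : ∀ a, CompleteSpace (space a)]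
  map : ∀ {a b : C}, (a ⟶ b) → space a →ₗᵢ[ℂ] space b
  map_id : ∀ (a : C) (x : space a), map (𝟙 a) x = x
  map_comp : ∀ {a b c : C} (f : a ⟶ b) (g : b ⟶ c) (x : space a),
    map (f ≫ g) x = map g (map f x)

attribute [instance] HilbFunctor.normed HilbFunctor.innerProduct HilbFunctor.complete

variable {C : Type} [Category.{0} C]

/-- A morphism with source `e`. -/
structure Arrow (e : C) where
  tgt : C
  arr : e ⟶ tgt

namespace Arrow

/-- `t ≤ s` if `s = ft` for some `f`. -/
instance (e : C) : Preorder (Arrow e) where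
  le t s := ∃ f : t.tgt ⟶ s.tgt, t.arr ≫ f = s.arr
  le_refl t := ⟨𝟙 _, Category.comp_id _⟩
  le_trans _ _ _ := fun ⟨f, hf⟩ ⟨g, hg⟩ => ⟨f ≫ g, by rw [← Category.assoc, hf, hg]⟩

instance (e : C) : Nonempty (Arrow e) := ⟨⟨e, 𝟙 e⟩⟩

theorem le_comp {e b c : C} (t : e ⟶ b) (f : b ⟶ c) : (⟨b, t⟩ : Arrow e) ≤ ⟨c, t ≫ f⟩ :=
  ⟨f, rfl⟩

variable [LeftCalculus C]

instance (e : C) : IsDirectedOrder (Arrow e) where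
  directed t s := by
    obtain ⟨c, f, g, h⟩ := LeftCalculus.ore t.arr s.arr
    exact ⟨⟨c, t.arr ≫ f⟩, ⟨f, rfl⟩, ⟨g, h.symm⟩⟩

end Arrow

namespace HilbFunctor

variable [LeftCalculus C] (Φ : HilbFunctor C)

/-- The connecting isometry `Φ(f)` of the directed system, where `s = ft`. -/
def trans {e : C} (t s : Arrow e) (h : t ≤ s) : Φ.space t.tgt →ₗᵢ[ℂ] Φ.space s.tgt :=
  Φ.map h.choose

theorem trans_eq {e : C} {t s : Arrow e} (h : t ≤ s) (f : t.tgt ⟶ s.tgt)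
    (hf : t.arr ≫ f = s.arr) (x : Φ.space t.tgt) : Φ.trans t s h x = Φ.map f x := by
  obtain ⟨_, g, hg⟩ := LeftCalculus.cancel t.arr h.choose f (h.choose_spec.trans hf.symm)
  apply (Φ.map g).injective
  rw [trans, ← Φ.map_comp, ← Φ.map_comp, hg]

instance (e : C) : DirectedSystem (fun t : Arrow e => Φ.space t.tgt) (Φ.trans · · ·) where
  map_self t x := by rw [Φ.trans_eq le_rfl (𝟙 _) (Category.comp_id _), Φ.map_id]
  map_map := by
    intro k j i ⟨f, hf⟩ ⟨g, hg⟩ x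
    rw [Φ.trans_eq _ f hf, Φ.trans_eq _ g hg,
      Φ.trans_eq _ (f ≫ g) (by rw [← Category.assoc, hf, hg]), Φ.map_comp]

/-- The inductive limit of the spaces `Φ(b)` over the directed set of all morphisms `t : e ⟶ b`. -/
def PreLimit (e : C) : Type := DirectLimit (fun t : Arrow e => Φ.space t.tgt) Φ.trans

instance (e : C) : AddCommGroup (Φ.PreLimit e) :=
  inferInstanceAs (AddCommGroup (DirectLimit (fun t : Arrow e => Φ.space t.tgt) Φ.trans))

instance (e : C) : Module ℂ (Φ.PreLimit e) :=
  inferInstanceAs (Module ℂ (DirectLimit (fun t : Arrow e => Φ.space t.tgt) Φ.trans))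

/-- The inner product of the inductive limit. -/
def preInner (e : C) : Φ.PreLimit e → Φ.PreLimit e → ℂ :=
  DirectLimit.lift₂ Φ.trans Φ.trans (fun _ x y => inner ℂ x y)
    (fun _ _ h x y => ((Φ.trans _ _ h).inner_map_map x y).symm)

/-- The class `t / x` of `(t, x)`, with `t : e ⟶ b` and `x ∈ Φ(b)`, in the inductive limit. -/
def frac {e b : C} (t : e ⟶ b) (x : Φ.space b) : Φ.PreLimit e :=
  (⟦⟨⟨b, t⟩, x⟩⟧ : DirectLimit (fun t : Arrow e => Φ.space t.tgt) Φ.trans)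

theorem frac_comp {e b c : C} (t : e ⟶ b) (f : b ⟶ c) (x : Φ.space b) :
    Φ.frac (t ≫ f) (Φ.map f x) = Φ.frac t x := by
  have h := DirectLimit.mk_apply (f := Φ.trans) ⟨b, t⟩ ⟨c, t ≫ f⟩ x (Arrow.le_comp t f)
  rwa [Φ.trans_eq _ f rfl] at h

theorem ind {e : C} {P : Φ.PreLimit e → Prop}
    (h : ∀ (b : C) (t : e ⟶ b) (x : Φ.space b), P (Φ.frac t x)) (v : Φ.PreLimit e) : P v :=
  DirectLimit.induction Φ.trans (fun t x => h t.tgt t.arr x) v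

theorem ind₂ {e : C} {P : Φ.PreLimit e → Φ.PreLimit e → Prop}
    (h : ∀ (b : C) (t : e ⟶ b) (x y : Φ.space b), P (Φ.frac t x) (Φ.frac t y))
    (v w : Φ.PreLimit e) : P v w :=
  DirectLimit.induction₂ Φ.trans (fun t x y => h t.tgt t.arr x y) v w

theorem ind₃ {e : C} {P : Φ.PreLimit e → Φ.PreLimit e → Φ.PreLimit e → Prop}
    (h : ∀ (b : C) (t : e ⟶ b) (x y z : Φ.space b), P (Φ.frac t x) (Φ.frac t y) (Φ.frac t z))
    (u v w : Φ.PreLimit e) : P u v w :=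
  DirectLimit.induction₃ Φ.trans (fun t x y z => h t.tgt t.arr x y z) u v w

theorem frac_add {e b : C} (t : e ⟶ b) (x y : Φ.space b) :
    Φ.frac t (x + y) = Φ.frac t x + Φ.frac t y :=
  (DirectLimit.add_def (G := fun t : Arrow e => Φ.space t.tgt) (f := Φ.trans) ⟨b, t⟩ x y).symm

theorem frac_smul {e b : C} (t : e ⟶ b) (c : ℂ) (x : Φ.space b) :
    Φ.frac t (c • x) = c • Φ.frac t x :=
  (DirectLimit.smul_def (G := fun t : Arrow e => Φ.space t.tgt) (f := Φ.trans) ⟨b, t⟩ x c).symm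

theorem frac_zero {e b : C} (t : e ⟶ b) : Φ.frac t 0 = 0 :=
  (DirectLimit.zero_def (f := Φ.trans) ⟨b, t⟩).symm

theorem preInner_frac {e b : C} (t : e ⟶ b) (x y : Φ.space b) :
    Φ.preInner e (Φ.frac t x) (Φ.frac t y) = inner ℂ x y :=
  DirectLimit.lift₂_def Φ.trans Φ.trans (fun _ x y => inner ℂ x y)
    (fun _ _ h x y => ((Φ.trans _ _ h).inner_map_map x y).symm) (⟨b, t⟩ : Arrow e) x y


/-- The inductive limit is a pre-Hilbert space. -/
abbrev core (e : C) : InnerProductSpace.Core ℂ (Φ.PreLimit e) where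
  inner := Φ.preInner e
  conj_inner_symm := Φ.ind₂ fun _ _ _ _ => by
    rw [preInner_frac, preInner_frac, inner_conj_symm]
  re_inner_nonneg := Φ.ind fun _ _ _ => by
    rw [preInner_frac]; exact inner_self_nonneg
  add_left := Φ.ind₃ fun _ _ _ _ _ => by
    rw [← frac_add, preInner_frac, preInner_frac, preInner_frac, inner_add_left]
  smul_left v w c := by
    revert v w
    exact Φ.ind₂ fun _ _ _ _ => by
      rw [← frac_smul, preInner_frac, preInner_frac, inner_smul_left]
  definite := Φ.ind fun _ _ _ h => by
    rw [preInner_frac, inner_self_eq_zero] at h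
    rw [h, frac_zero]

instance (e : C) : NormedAddCommGroup (Φ.PreLimit e) := (Φ.core e).toNormedAddCommGroup

instance (e : C) : InnerProductSpace ℂ (Φ.PreLimit e) := InnerProductSpace.ofCore (Φ.core e).toCore

theorem inner_frac {e b : C} (t : e ⟶ b) (x y : Φ.space b) :
    inner ℂ (Φ.frac t x) (Φ.frac t y) = inner ℂ x y :=
  Φ.preInner_frac t x y

theorem norm_frac {e b : C} (t : e ⟶ b) (x : Φ.space b) : ‖Φ.frac t x‖ = ‖x‖ := by
  rw [@norm_eq_sqrt_re_inner ℂ, @norm_eq_sqrt_re_inner ℂ, inner_frac]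

/-- For `f : e ⟶ e'`, the map `t / x ↦ tf / x` between the limits at `e'` and at `e`. -/
def pullFun {e e' : C} (f : e ⟶ e') : Φ.PreLimit e' → Φ.PreLimit e :=
  DirectLimit.lift Φ.trans (fun t x => Φ.frac (f ≫ t.arr) x) (by
    rintro i j ⟨g, hg⟩ x
    rw [Φ.trans_eq _ g hg, ← hg, ← Category.assoc, frac_comp])

theorem pullFun_frac {e e' b : C} (f : e ⟶ e') (t : e' ⟶ b) (x : Φ.space b) :
    Φ.pullFun f (Φ.frac t x) = Φ.frac (f ≫ t) x := rfl

theorem pullFun_surjective {e e' : C} (f : e ⟶ e') : Function.Surjective (Φ.pullFun f) :=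
  Φ.ind fun _ t x => by
    obtain ⟨_, h, k, hk⟩ := LeftCalculus.ore f t
    exact ⟨Φ.frac h (Φ.map k x), by rw [pullFun_frac, hk, frac_comp]⟩

/-- The map `t / x ↦ tf / x` as a surjective linear isometry. -/
def pull {e e' : C} (f : e ⟶ e') : Φ.PreLimit e' ≃ₗᵢ[ℂ] Φ.PreLimit e :=
  LinearIsometryEquiv.ofSurjective
    { toFun := Φ.pullFun f
      map_add' := Φ.ind₂ fun _ _ _ _ => by
        rw [← frac_add, pullFun_frac, pullFun_frac, pullFun_frac, frac_add]
      map_smul' := fun c => Φ.ind fun _ _ _ => by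
        rw [← frac_smul, pullFun_frac, pullFun_frac, frac_smul, RingHom.id_apply]
      norm_map' := Φ.ind fun _ _ _ => (Φ.norm_frac _ _).trans (Φ.norm_frac _ _).symm }
    (Φ.pullFun_surjective f)

theorem pull_frac {e e' b : C} (f : e ⟶ e') (t : e' ⟶ b) (x : Φ.space b) :
    Φ.pull f (Φ.frac t x) = Φ.frac (f ≫ t) x := rfl

theorem pull_comp {e e' e'' : C} (f : e ⟶ e') (g : e' ⟶ e'') (v : Φ.PreLimit e'') :
    Φ.pull (f ≫ g) v = Φ.pull f (Φ.pull g v) := by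
  revert v
  exact Φ.ind fun _ _ _ => by simp only [pull_frac, Category.assoc]

/-- The Jones action on the inductive limit: `t / s` sends `s / x` to `t / x`. -/
def preAction (e : C) : FractionGroup e →* (Φ.PreLimit e ≃ₗᵢ[ℂ] Φ.PreLimit e) where
  toFun := Quot.lift (fun v => (Φ.pull v.den).symm.trans (Φ.pull v.num)) (by
    rintro ⟨_, t, s⟩ ⟨_, t', s'⟩ ⟨f, h₁, h₂⟩
    dsimp only at f h₁ h₂
    subst h₁ h₂
    ext v
    obtain ⟨w, rfl⟩ := (Φ.pull (s ≫ f)).surjective v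
    change Φ.pull t ((Φ.pull s).symm _) = Φ.pull (t ≫ f) ((Φ.pull (s ≫ f)).symm _)
    rw [LinearIsometryEquiv.symm_apply_apply, pull_comp, pull_comp,
      LinearIsometryEquiv.symm_apply_apply])
  map_one' := by
    ext v
    exact (Φ.pull (𝟙 e)).apply_symm_apply v
  map_mul' x y := by
    induction x using FractionGroup.ind with | h a t s =>
    induction y using FractionGroup.ind with | h b t' s' =>
    obtain ⟨_, f, f', hf⟩ := LeftCalculus.ore s t'
    rw [FractionGroup.mk_mul_mk t s t' s' f f' hf]
    ext v
    obtain ⟨w, rfl⟩ := (Φ.pull (s' ≫ f')).surjective v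
    change Φ.pull (t ≫ f) ((Φ.pull (s' ≫ f')).symm _) =
      Φ.pull t ((Φ.pull s).symm (Φ.pull t' ((Φ.pull s').symm _)))
    simp only [LinearIsometryEquiv.symm_apply_apply]
    simp only [pull_comp, LinearIsometryEquiv.symm_apply_apply]
    rw [← pull_comp Φ t', ← hf, pull_comp]
    simp

/-- The defining formula `(t / s) · (r / x) = pt / Φ(q)x`, where `ps = qr`. -/
theorem preAction_mk {e b c d : C} (t s : e ⟶ b) (r : e ⟶ c) (x : Φ.space c)
    (p : b ⟶ d) (q : c ⟶ d) (h : s ≫ p = r ≫ q) :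
    Φ.preAction e (FractionGroup.mk t s) (Φ.frac r x) = Φ.frac (t ≫ p) (Φ.map q x) := by
  change Φ.pull t ((Φ.pull s).symm (Φ.frac r x)) = _
  rw [← Φ.frac_comp r q, ← h, ← pull_frac, ← pull_frac, LinearIsometryEquiv.symm_apply_apply]

/-- The Hilbert space completion of the inductive limit. -/
abbrev LimitSpace (e : C) : Type := UniformSpace.Completion (Φ.PreLimit e)

instance (e : C) : CompleteSpace (Φ.LimitSpace e) := inferInstance

/-- The extension of a surjective linear isometry to the completion. -/
def completionEquiv {e : C} (u : Φ.PreLimit e ≃ₗᵢ[ℂ] Φ.PreLimit e) :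
    Φ.LimitSpace e ≃ₗᵢ[ℂ] Φ.LimitSpace e :=
  u.toLinearEquiv.extendOfIsometry
    (UniformSpace.Completion.toComplₗᵢ (𝕜 := ℂ) (E := Φ.PreLimit e)).toLinearMap
    (UniformSpace.Completion.toComplₗᵢ (𝕜 := ℂ) (E := Φ.PreLimit e)).toLinearMap
    UniformSpace.Completion.denseRange_coe UniformSpace.Completion.denseRange_coe
    (fun x => by simp)

theorem completionEquiv_coe {e : C} (u : Φ.PreLimit e ≃ₗᵢ[ℂ] Φ.PreLimit e) (x : Φ.PreLimit e) :
    Φ.completionEquiv u (x : Φ.LimitSpace e) = (u x : Φ.LimitSpace e) :=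
  LinearEquiv.extendOfIsometry_eq _ _ _ _ _ _ x

/-- The Jones representation: the unitary representation of the group of fractions on the completed
inductive limit that extends the Jones action. -/
def jonesRep (e : C) : FractionGroup e →* (Φ.LimitSpace e ≃ₗᵢ[ℂ] Φ.LimitSpace e) where
  toFun v := Φ.completionEquiv (Φ.preAction e v)
  map_one' := by
    ext v
    induction v using UniformSpace.Completion.induction_on with
    | hp => exact isClosed_eq (LinearIsometryEquiv.continuous _) continuous_id
    | ih x => rw [completionEquiv_coe, map_one]; rfl
  map_mul' v w := by
    ext z
    induction z using UniformSpace.Completion.induction_on with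
    | hp => exact isClosed_eq (LinearIsometryEquiv.continuous _) (LinearIsometryEquiv.continuous _)
    | ih x =>
      rw [LinearIsometryEquiv.coe_mul, Function.comp_apply, completionEquiv_coe,
        completionEquiv_coe, completionEquiv_coe, map_mul]
      rfl

/-- The vector `x ∈ Φ(e)`, seen in the limit space at the identity of `e`. -/
def base (e : C) (x : Φ.space e) : Φ.LimitSpace e := (Φ.frac (𝟙 e) x : Φ.PreLimit e)

/-- The coefficient `v ↦ ⟨π(v)x, x⟩` of the Jones representation, for `x ∈ Φ(e)`
(Mathlib's inner product is linear in the second variable). -/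
def coefficient (e : C) (x : Φ.space e) (v : FractionGroup e) : ℂ :=
  inner ℂ (Φ.base e x) (Φ.jonesRep e v (Φ.base e x))

/-- `⟨π(t / s)x, x⟩ = ⟨Φ(s)x, Φ(t)x⟩`. -/
theorem coefficient_mk {e b : C} (x : Φ.space e) (t s : e ⟶ b) :
    Φ.coefficient e x (FractionGroup.mk t s) = inner ℂ (Φ.map t x) (Φ.map s x) := by
  have h1 : Φ.jonesRep e (FractionGroup.mk t s) (Φ.base e x) =
      (Φ.frac t (Φ.map s x) : Φ.PreLimit e) := by
    have h := Φ.preAction_mk t s (𝟙 e) x (𝟙 b) s (by simp)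
    rw [Category.comp_id] at h
    rw [← h]
    exact Φ.completionEquiv_coe _ _
  have h2 : Φ.base e x = (Φ.frac t (Φ.map t x) : Φ.PreLimit e) := by
    rw [base, ← Φ.frac_comp (𝟙 e) t x, Category.id_comp]
  rw [coefficient, h1, h2, UniformSpace.Completion.inner_coe, inner_frac]

end HilbFunctor
end JonesAction
section Forests

/-- Finite ordered rooted binary trees with leaves labelled by `J`. -/
inductive BinTree (J : Type)
  | leaf : J → BinTree J
  | node : BinTree J → BinTree J → BinTree J

/-- The multiset of labels of the leaves. -/
def leaves {J : Type} : BinTree J → Multiset J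
  | .leaf j => {j}
  | .node l r => leaves l + leaves r

/-- Attach the tree `g j` to each leaf labelled `j`. -/
def graft {J K : Type} (g : J → BinTree K) : BinTree J → BinTree K
  | .leaf j => g j
  | .node l r => .node (graft g l) (graft g r)

theorem leaves_graft {J K : Type} (g : J → BinTree K) (t : BinTree J) :
    leaves (graft g t) = (leaves t).bind fun j => leaves (g j) := by
  induction t with
  | leaf j => simp [graft, leaves]
  | node l r hl hr => simp_all [graft, leaves]

theorem graft_leaf {J : Type} (t : BinTree J) : graft .leaf t = t := by
  induction t with
  | leaf j => rfl
  | node l r hl hr => simp [graft, hl, hr]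

theorem graft_graft {J K L : Type} (g : J → BinTree K) (h : K → BinTree L)
    (t : BinTree J) : graft h (graft g t) = graft (fun j => graft h (g j)) t := by
  induction t with
  | leaf j => rfl
  | node l r hl hr => simp [graft, hl, hr]

theorem graft_congr {J K : Type} {g h : J → BinTree K} {t : BinTree J} :
    graft g t = graft h t ↔ ∀ j ∈ leaves t, g j = h j := by
  induction t with
  | leaf j => simp [graft, leaves]
  | node l r hl hr =>
    simp only [graft, leaves, Multiset.mem_add, or_imp, forall_and, ← hl, ← hr]
    exact ⟨fun e => by injection e with e₁ e₂; exact ⟨e₁, e₂⟩, fun e => by rw [e.1, e.2]⟩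

/-- Each label `j : J` is carried by exactly one leaf of the forest `p`. -/
def IsLabelling {I J : Type} [Fintype I] [Fintype J] (p : I → BinTree J) : Prop :=
  ∑ i, leaves (p i) = (Finset.univ : Finset J).val

theorem IsLabelling.comp {I J K : Type} [Fintype I] [Fintype J] [Fintype K]
    {p : I → BinTree J} {q : J → BinTree K} (hp : IsLabelling p) :
    IsLabelling (fun i => graft q (p i)) ↔ IsLabelling q := by
  have h : ∑ i, leaves (graft q (p i)) = ∑ j, leaves (q j) := by
    simp only [leaves_graft]
    have h2 : ∀ s : Finset I, ∑ i ∈ s, (leaves (p i)).bind (fun j => leaves (q j)) =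
        (∑ i ∈ s, leaves (p i)).bind fun j => leaves (q j) := by
      classical
      intro s
      induction s using Finset.induction_on with
      | empty => simp
      | insert a s ha ih => simp [Finset.sum_insert ha, ih]
    rw [h2, hp]
    rfl
  simp only [IsLabelling, h]

theorem IsLabelling.exists_mem {I J : Type} [Fintype I] [Fintype J]
    {p : I → BinTree J} (hp : IsLabelling p) (j : J) : ∃ i, j ∈ leaves (p i) := by
  have : j ∈ ∑ i, leaves (p i) := by rw [hp]; exact Finset.mem_univ j
  simpa [Multiset.mem_sum] using this

theorem IsLabelling.nodup {I J : Type} [Fintype I] [Fintype J]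
    {p : I → BinTree J} (hp : IsLabelling p) (i : I) : (leaves (p i)).Nodup := by
  apply Multiset.nodup_of_le _ (hp ▸ Finset.univ.nodup : (∑ i, leaves (p i)).Nodup)
  exact Finset.single_le_sum (f := fun i => leaves (p i)) (fun _ _ => Multiset.zero_le _)
    (Finset.mem_univ i)

theorem IsLabelling.unique {I J : Type} [Fintype I] [Fintype J]
    {p : I → BinTree J} (hp : IsLabelling p) {i i' : I} {j : J}
    (h : j ∈ leaves (p i)) (h' : j ∈ leaves (p i')) : i = i' := by
  classical
  by_contra hne
  have h1 : Multiset.count j (∑ i, leaves (p i)) = 1 := by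
    rw [hp]; exact Multiset.count_eq_one_of_mem Finset.univ.nodup (Finset.mem_univ j)
  rw [Multiset.count_sum'] at h1
  have h2 := Finset.sum_le_sum_of_subset (f := fun i => Multiset.count j (leaves (p i)))
    (Finset.subset_univ {i, i'})
  rw [Finset.sum_pair hne, h1] at h2
  have := Multiset.count_pos.2 h
  have := Multiset.count_pos.2 h'
  omega

/-- The objects `1, 2, 3, …` of the category of symmetric forests. -/
structure SymForest where
  width : ℕ+

namespace SymForest

/-- A symmetric forest with `n` roots and `m` leaves: a list of `n` binary trees whose leaves are
labelled bijectively by `1, …, m` (here `Fin m`). A pair `(p, σ)` of a planar forest `p` and a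
permutation `σ ∈ S_m` is the forest `p` whose `i`-th leaf carries the label `σ(i)`. -/
@[ext]
structure Hom (X Y : SymForest) where
  tree : Fin X.width → BinTree (Fin Y.width)
  isLabelling : IsLabelling tree

/-- Composition is stacking: `p ≫ q` attaches the `j`-th tree of `q` to the leaf of `p` labelled
`j`. -/
instance : Category.{0} SymForest where
  Hom := Hom
  id X := ⟨.leaf, by simp [IsLabelling, leaves, Finset.sum_multiset_singleton]⟩
  comp p q := ⟨fun i => graft q.tree (p.tree i), (IsLabelling.comp p.isLabelling).2 q.isLabelling⟩
  id_comp _ := rfl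
  comp_id p := Hom.ext (funext fun i => graft_leaf (p.tree i))
  assoc p q r := Hom.ext (funext fun i => graft_graft q.tree r.tree (p.tree i))

theorem comp_tree {X Y Z : SymForest} (p : X ⟶ Y) (q : Y ⟶ Z) (i : Fin X.width) :
    (p ≫ q).tree i = graft q.tree (p.tree i) := rfl

end SymForest

/-- The complete binary tree of depth `d`. -/
def fullTree {K : Type} : (d : ℕ) → ((Fin d → Bool) → K) → BinTree K
  | 0, c => .leaf (c Fin.elim0)
  | d + 1, c => .node (fullTree d fun u => c (Fin.cons false u))
      (fullTree d fun u => c (Fin.cons true u))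

theorem map_univ_val {T K : Type} [Fintype T] (f : T → K) :
    (Finset.univ : Finset T).val.map f = ∑ t, {f t} := by
  have h := Multiset.sum_map_singleton ((Finset.univ : Finset T).val.map f)
  rw [Multiset.map_map] at h
  exact h.symm

theorem map_univ_val_equiv {T K : Type} [Fintype T] [Fintype K] (f : T ≃ K) :
    (Finset.univ : Finset T).val.map f = (Finset.univ : Finset K).val := by
  rw [← Finset.map_univ_equiv f]; rfl

theorem leaves_fullTree {K : Type} (d : ℕ) (c : (Fin d → Bool) → K) :
    leaves (fullTree d c) = (Finset.univ : Finset (Fin d → Bool)).val.map c := by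
  induction d with
  | zero =>
    simp only [fullTree, leaves, Finset.univ_unique, Finset.singleton_val, Multiset.map_singleton]
    exact congrArg (fun u => {c u}) (Subsingleton.elim _ _)
  | succ d ih =>
    simp only [fullTree, leaves, ih]
    classical
    have h := (Fin.consEquiv (fun _ : Fin (d+1) => Bool)).sum_comp (fun u => ({c u} : Multiset K))
    rw [map_univ_val, map_univ_val, map_univ_val, ← h, Fintype.sum_prod_type, Fintype.sum_bool, add_comm]
    rfl

/-- The depth of a tree. -/
def depth {J : Type} : BinTree J → ℕ
  | .leaf _ => 0
  | .node l r => max (depth l) (depth r) + 1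

theorem exists_graft_eq_fullTree {J K : Type} (t : BinTree J) (ht : (leaves t).Nodup) :
    ∀ (d : ℕ) (_ : depth t ≤ d) (c : (Fin d → Bool) → K), ∃ g : J → BinTree K,
      graft g t = fullTree d c := by
  classical
  induction t with
  | leaf j => exact fun d _ c => ⟨fun _ => fullTree d c, rfl⟩
  | node l r hl hr =>
    rintro (_ | d) hd c
    · simp [depth] at hd
    · obtain ⟨h1, h2, h3⟩ := Multiset.nodup_add.1 ht
      simp only [depth, Nat.add_le_add_iff_right, max_le_iff] at hd
      obtain ⟨gl, hgl⟩ := hl h1 d hd.1 fun u => c (Fin.cons false u)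
      obtain ⟨gr, hgr⟩ := hr h2 d hd.2 fun u => c (Fin.cons true u)
      refine ⟨fun j => if j ∈ leaves l then gl j else gr j, ?_⟩
      simp only [graft, fullTree, ← hgl, ← hgr]
      congr 1
      · exact graft_congr.2 fun j hj => if_pos hj
      · exact graft_congr.2 fun j hj => if_neg fun hj' => Multiset.disjoint_left.1 h3 hj' hj

namespace SymForest

/-- The forest all of whose trees are complete of depth `d`. -/
def fullForest (X : SymForest) (d : ℕ) : X ⟶ ⟨X.width * 2 ^ d⟩ where
  tree i := fullTree d fun u =>
    (Fintype.equivFinOfCardEq (α := Fin X.width × (Fin d → Bool))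
      (n := (X.width * 2 ^ d : ℕ+)) (by simp)) (i, u)
  isLabelling := by
    unfold IsLabelling
    simp only [leaves_fullTree, map_univ_val]
    rw [← map_univ_val_equiv (Fintype.equivFinOfCardEq (α := Fin X.width × (Fin d → Bool))
      (n := (X.width * 2 ^ d : ℕ+)) (by simp)), map_univ_val, Fintype.sum_prod_type]

theorem exists_comp_eq_fullForest {X Y : SymForest} (p : X ⟶ Y) (d : ℕ)
    (hd : ∀ i, depth (p.tree i) ≤ d) : ∃ h : Y ⟶ _, p ≫ h = fullForest X d := by
  choose g hg using fun i => exists_graft_eq_fullTree (p.tree i) (p.isLabelling.nodup i) d (hd i)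
    fun u => (Fintype.equivFinOfCardEq (α := Fin X.width × (Fin d → Bool))
      (n := (X.width * 2 ^ d : ℕ+)) (by simp)) (i, u)
  choose root hroot using p.isLabelling.exists_mem
  have key : ∀ i, graft (fun j => g (root j) j) (p.tree i) = (fullForest X d).tree i := fun i =>
    (graft_congr.2 fun j hj => by rw [p.isLabelling.unique (hroot j) hj]).trans (hg i)
  refine ⟨⟨fun j => g (root j) j, (IsLabelling.comp p.isLabelling).1 ?_⟩, Hom.ext (funext key)⟩
  simp only [key]
  exact (fullForest X d).isLabelling

end SymForest

instance : LeftCalculus SymForest where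
  ore p q := by
    obtain ⟨d, hd⟩ : ∃ d, (∀ i, depth (p.tree i) ≤ d) ∧ (∀ i, depth (q.tree i) ≤ d) :=
      ⟨(∑ i, depth (p.tree i)) + ∑ i, depth (q.tree i),
        fun i => (Finset.single_le_sum (f := fun i => depth (p.tree i)) (fun _ _ => Nat.zero_le _)
          (Finset.mem_univ i)).trans (Nat.le_add_right _ _),
        fun i => (Finset.single_le_sum (f := fun i => depth (q.tree i)) (fun _ _ => Nat.zero_le _)
          (Finset.mem_univ i)).trans (Nat.le_add_left _ _)⟩
    obtain ⟨h, hh⟩ := SymForest.exists_comp_eq_fullForest p d hd.1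
    obtain ⟨k, hk⟩ := SymForest.exists_comp_eq_fullForest q d hd.2
    exact ⟨_, h, k, hh.trans hk.symm⟩
  cancel f p q h := by
    refine ⟨_, 𝟙 _, ?_⟩
    have : p = q := SymForest.Hom.ext (funext fun j => by
      obtain ⟨i, hi⟩ := f.isLabelling.exists_mem j
      exact graft_congr.1 (congrFun (congrArg SymForest.Hom.tree h) i) j hi)
    rw [this]

/-- The free monoid `M` on the letters `a₀, b₀, a₁, b₁, …`. -/
abbrev Word : Type := FreeMonoid (ℕ ⊕ ℕ)

/-- The letter `a_j`. -/
def genA (j : ℕ) : Word := FreeMonoid.of (Sum.inl j)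
/-- The letter `b_j`. -/
def genB (j : ℕ) : Word := FreeMonoid.of (Sum.inr j)

/-- The submonoid `M_j` generated by the `a_i`, `b_i` with `i ≤ j`. -/
def wordsUpTo (j : ℕ) : Submonoid Word :=
  Submonoid.closure {w | ∃ i ≤ j, w = genA i ∨ w = genB i}

/-- The least `j` with `x ∈ M_j`; for `x ≠ e` this means `x ∈ M_j \ M_{j-1}` (with `M_{-1} = {e}`). -/
def level (x : Word) : ℕ := sInf {j | x ∈ wordsUpTo j}

open Classical in
/-- The two pairs of words in `R_α δ_x`. For `x = e` they are `(e, e)` (`s = false`) and `(a₀, b₀)`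
(`s = true`). For `x ≠ e` with `x ∈ M_j \ M_{j-1}` they are `(x a_j, x b_j)` and
`(x a_{j+1}, x b_{j+1})`. -/
def branch (s : Bool) (x : Word) : Word × Word :=
  if x = 1 then (if s then (genA 0, genB 0) else (1, 1))
  else (x * genA (level x + s.toNat), x * genB (level x + s.toNat))

theorem mul_genA_inj {x y : Word} {i j : ℕ} (h : x * genA i = y * genA j) : x = y ∧ i = j := by
  have h' : x.toList ++ [Sum.inl i] = y.toList ++ [Sum.inl j] := congrArg FreeMonoid.toList h
  obtain ⟨h1, h2⟩ := List.append_inj' h' rfl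
  simp only [List.cons.injEq, Sum.inl.injEq, and_true] at h2
  exact ⟨FreeMonoid.toList.injective h1, h2⟩

theorem genA_ne_one (i : ℕ) : genA i ≠ 1 := fun h => by
  have h' : [Sum.inl i] = ([] : List (ℕ ⊕ ℕ)) := congrArg FreeMonoid.toList h
  simp at h'

theorem branch_injective : Function.Injective fun p : Bool × Word => branch p.1 p.2 := by
  have key : ∀ (x : Word) (i j : ℕ), genA i = x * genA j → x = 1 := fun x i j h =>
    (mul_genA_inj ((one_mul _).trans h)).1.symm
  have key' : ∀ (x : Word) (j : ℕ), x * genA j ≠ 1 := fun x j h => by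
    have h' : x.toList ++ [Sum.inl j] = ([] : List (ℕ ⊕ ℕ)) := congrArg FreeMonoid.toList h
    simp at h'
  rintro ⟨s, x⟩ ⟨s', x'⟩ h
  have h1 : (branch s x).1 = (branch s' x').1 := congrArg Prod.fst h
  have e : s.toNat = s'.toNat → s = s' := fun h => by
    cases s <;> cases s' <;> simp_all
  unfold branch at h1
  by_cases hx : x = 1 <;> by_cases hx' : x' = 1
  · subst hx hx'
    cases s <;> cases s' <;> simp [genA_ne_one, (genA_ne_one _).symm] at h1 ⊢
  · rw [if_pos hx, if_neg hx'] at h1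
    cases s
    · exact absurd h1.symm (key' _ _)
    · exact absurd (key _ _ _ h1) hx'
  · rw [if_neg hx, if_pos hx'] at h1
    cases s'
    · exact absurd h1 (key' _ _)
    · exact absurd (key _ _ _ h1.symm) hx
  · rw [if_neg hx, if_neg hx'] at h1
    obtain ⟨rfl, h2⟩ := mul_genA_inj h1
    rw [e (Nat.add_left_cancel h2)]

/-- The partial inverse of the injective map `(s, x) ↦ branch s x`. -/
def join (y : Word × Word) : Option (Bool × Word) :=
  Function.partialInv (fun p : Bool × Word => branch p.1 p.2) y

theorem join_eq_some {y : Word × Word} {s : Bool} {x : Word} :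
    join y = some (s, x) ↔ branch s x = y :=
  branch_injective.isPartialInv (s, x) y

/-- The weights `α` and `β = √(1 - α²)` of the two terms of `R_α`. -/
def stateWeight (α : ℝ) (s : Bool) : ℝ := if s then √(1 - α ^ 2) else α

/-- The word `x` with `y = branch s x` for some `s`, if there is one. -/
def parent (y : Word × Word) : Word := ((join y).map Prod.snd).getD 1

/-- The weight of `δ_y` in `R_α δ_x`, where `x = parent y`; it is `0` if `y` is no `branch s x`. -/
def parentWeight (α : ℝ) (y : Word × Word) : ℝ :=
  ((join y).map fun p => stateWeight α p.1).getD 0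

theorem parent_branch (s : Bool) (x : Word) : parent (branch s x) = x := by
  rw [parent, join_eq_some.2 rfl]; rfl

theorem parentWeight_branch (α : ℝ) (s : Bool) (x : Word) :
    parentWeight α (branch s x) = stateWeight α s := by
  rw [parentWeight, join_eq_some.2 rfl]; rfl

theorem parentWeight_eq_zero (α : ℝ) {y : Word × Word} (h : ∀ s x, branch s x ≠ y) :
    parentWeight α y = 0 := by
  rw [parentWeight]
  cases hj : join y with
  | none => rfl
  | some p => exact absurd (join_eq_some.1 hj) (h _ _)

/-- Given words at the leaves of a tree, the only word `x` at its root for which the tensor of the leaf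
words can occur in the image of `δ_x`. -/
def rootWord {J : Type} (y : J → Word) : BinTree J → Word
  | .leaf j => y j
  | .node l r => parent (rootWord y l, rootWord y r)

/-- The weight with which the tensor of the leaf words occurs in the image of `δ_x` under the operator
of the tree, `x` being its `rootWord`. -/
def rootWeight (α : ℝ) {J : Type} (y : J → Word) : BinTree J → ℝ
  | .leaf _ => 1
  | .node l r => parentWeight α (rootWord y l, rootWord y r) *
      (rootWeight α y l * rootWeight α y r)

theorem rootWord_graft {J K : Type} (g : J → BinTree K) (z : K → Word) (t : BinTree J) :
    rootWord z (graft g t) = rootWord (fun j => rootWord z (g j)) t := by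
  induction t with
  | leaf j => rfl
  | node l r hl hr => simp [graft, rootWord, hl, hr]

theorem rootWeight_graft (α : ℝ) {J K : Type} (g : J → BinTree K) (z : K → Word)
    (t : BinTree J) : rootWeight α z (graft g t) =
      rootWeight α (fun j => rootWord z (g j)) t *
        ((leaves t).map fun j => rootWeight α z (g j)).prod := by
  induction t with
  | leaf j => simp [graft, rootWeight, leaves]
  | node l r hl hr =>
    simp only [graft, rootWeight, leaves, hl, hr, rootWord_graft, Multiset.map_add,
      Multiset.prod_add]
    ring

theorem IsLabelling.prod_prod {I J : Type} [Fintype I] [Fintype J] {p : I → BinTree J}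
    (hp : IsLabelling p) (w : J → ℝ) :
    ∏ i, ((leaves (p i)).map w).prod = ∏ j, w j := by
  classical
  have h : ∀ s : Finset I, ∏ i ∈ s, ((leaves (p i)).map w).prod =
      ((∑ i ∈ s, leaves (p i)).map w).prod := by
    intro s
    induction s using Finset.induction_on with
    | empty => simp
    | insert a s ha ih => simp [Finset.sum_insert ha, Finset.prod_insert ha, ih]
  rw [h, hp]
  rfl

/-- The number of inner vertices of a tree. -/
def nodes {J : Type} : BinTree J → ℕ
  | .leaf _ => 0
  | .node l r => nodes l + nodes r + 1

open scoped ENNReal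

theorem stateWeight_sq (α : unitInterval) :
    ENNReal.ofReal (stateWeight α false ^ 2) + ENNReal.ofReal (stateWeight α true ^ 2) = 1 := by
  have h0 := α.2.1
  have h1 := α.2.2
  have h : (0 : ℝ) ≤ 1 - (α : ℝ) ^ 2 := by nlinarith
  rw [← ENNReal.ofReal_add (sq_nonneg _) (sq_nonneg _)]
  simp [stateWeight, Real.sq_sqrt h]

theorem tsum_parent (α : unitInterval) (g : Word → ℝ≥0∞) :
    ∑' y : Word × Word, ENNReal.ofReal (parentWeight α y ^ 2) * g (parent y) = ∑' x, g x := by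
  have h := branch_injective.tsum_eq (f := fun y : Word × Word =>
    ENNReal.ofReal (parentWeight α y ^ 2) * g (parent y)) (by
      intro y hy
      by_contra hn
      apply hy
      simp only
      rw [parentWeight_eq_zero α (fun s x hs => hn ⟨(s, x), hs⟩)]
      simp)
  rw [← h, ENNReal.tsum_prod (f := fun s x => ENNReal.ofReal (parentWeight α (branch s x) ^ 2) *
    g (parent (branch s x))), tsum_bool]
  simp only [parent_branch, parentWeight_branch, ENNReal.tsum_mul_left]
  rw [← add_mul, stateWeight_sq, one_mul]

theorem tsum_forest (α : unitInterval) {J : Type} [Fintype J] :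
    ∀ (n : ℕ) {I : Type} [Fintype I] (p : I → BinTree J) (_ : IsLabelling p)
      (_ : ∑ i, nodes (p i) = n) (g : (I → Word) → ℝ≥0∞),
      ∑' y : J → Word, ENNReal.ofReal ((∏ i, rootWeight α y (p i)) ^ 2) *
        g (fun i => rootWord y (p i)) = ∑' x, g x := by
  classical
  intro n
  induction n with
  | zero =>
    intro I _ p hp hn g
    have h0 : ∀ i, ∃ j, p i = .leaf j := fun i => by
      have h := (Finset.sum_eq_zero_iff.1 hn) i (Finset.mem_univ i)
      cases hi : p i with
      | leaf j => exact ⟨j, rfl⟩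
      | node l r => rw [hi] at h; simp [nodes] at h
    choose c hc using h0
    have hbij : Function.Bijective c := by
      constructor
      · intro i i' h
        exact hp.unique (j := c i) (by simp [hc, leaves]) (by simp [hc, leaves, h])
      · intro j
        obtain ⟨i, hi⟩ := hp.exists_mem j
        rw [hc, leaves, Multiset.mem_singleton] at hi
        exact ⟨i, hi.symm⟩
    simp only [hc, rootWeight, rootWord]
    simp only [Finset.prod_const_one, one_pow, ENNReal.ofReal_one, one_mul]
    exact ((Equiv.ofBijective c hbij).arrowCongr (Equiv.refl Word)).symm.tsum_eq g
  | succ n ih =>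
    intro I _ p hp hn g
    obtain ⟨i, -, hi⟩ := Finset.exists_ne_zero_of_sum_ne_zero (s := Finset.univ)
      (f := fun i => nodes (p i)) (by rw [hn]; exact Nat.succ_ne_zero n)
    obtain ⟨l, r, hlr⟩ : ∃ l r, p i = .node l r := by
      cases h : p i with
      | leaf j => rw [h] at hi; exact absurd rfl hi
      | node l r => exact ⟨l, r, rfl⟩
    let q : Option (Option {k // k ≠ i}) → BinTree J := fun o =>
      o.elim r fun o' => o'.elim l fun k => p k
    have hsum : ∑ o, leaves (q o) = ∑ k, leaves (p k) := by
      rw [Fintype.sum_option, Fintype.sum_option, Fintype.sum_eq_add_sum_subtype_ne _ i, hlr]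
      simp only [q, Option.elim, leaves]
      abel
    have hnodes : ∑ o, nodes (q o) = n := by
      rw [Fintype.sum_eq_add_sum_subtype_ne _ i, hlr] at hn
      rw [Fintype.sum_option, Fintype.sum_option]
      simp only [q, Option.elim, nodes] at hn ⊢
      omega
    let glue : Word → ({k // k ≠ i} → Word) → I → Word := fun x u =>
      (Equiv.funSplitAt i Word).symm (x, u)
    let G : (Option (Option {k // k ≠ i}) → Word) → ℝ≥0∞ := fun z =>
      ENNReal.ofReal (parentWeight α (z (some none), z none) ^ 2) *
        g (glue (parent (z (some none), z none)) fun k => z (some (some k)))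
    have hq := ih q (hsum.trans hp) hnodes G
    have hterm : ∀ y : J → Word, ENNReal.ofReal ((∏ i, rootWeight α y (p i)) ^ 2) *
        g (fun i => rootWord y (p i)) = ENNReal.ofReal ((∏ o, rootWeight α y (q o)) ^ 2) *
        G (fun o => rootWord y (q o)) := by
      intro y
      have h1 : (fun k => rootWord y (p k)) =
          glue (rootWord y (p i)) fun k => rootWord y (p k) :=
        ((Equiv.funSplitAt i Word).symm_apply_apply fun k => rootWord y (p k)).symm
      rw [h1, Fintype.prod_eq_mul_prod_subtype_ne _ i, Fintype.prod_option, Fintype.prod_option,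
        hlr]
      simp only [q, Option.elim, G, rootWeight, rootWord]
      rw [← mul_assoc (ENNReal.ofReal _), ← ENNReal.ofReal_mul (sq_nonneg _)]
      congr 2
      ring
    simp only [hterm, hq]
    let E₁ : (Option (Option {k // k ≠ i}) → Word) ≃
        ({k // k ≠ i} → Word) × (Word × Word) :=
      { toFun := fun z => (fun k => z (some (some k)), (z (some none), z none))
        invFun := fun w o => o.elim w.2.2 fun o' => o'.elim w.2.1 w.1
        left_inv := fun z => funext fun o => by rcases o with _ | _ | _ <;> rfl
        right_inv := fun _ => rfl }
    rw [← E₁.symm.tsum_eq G, ← (Equiv.funSplitAt i Word).symm.tsum_eq g,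
      ENNReal.tsum_prod (f := fun u w => G (E₁.symm (u, w))),
      ENNReal.tsum_prod (f := fun x u => g ((Equiv.funSplitAt i Word).symm (x, u))),
      ENNReal.tsum_comm (f := fun x u => g ((Equiv.funSplitAt i Word).symm (x, u)))]
    exact tsum_congr fun u => tsum_parent α fun x => g (glue x u)

/-- `ℓ²(Mⁿ)`, that is, the `n`-th tensor power of `ℓ²(M)`. -/
abbrev WordSpace (X : SymForest) : Type := lp (fun _ : Fin X.width → Word => ℂ) 2

open scoped NNReal

/-- The product of the weights of the trees of a forest. -/
def forestWeight (α : ℝ) {X Y : SymForest} (p : X ⟶ Y) (y : Fin Y.width → Word) : ℝ :=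
  ∏ i, rootWeight α y (p.tree i)

/-- The tuple of the root words of the trees of a forest. -/
def forestWord {X Y : SymForest} (p : X ⟶ Y) (y : Fin Y.width → Word) : Fin X.width → Word :=
  fun i => rootWord y (p.tree i)

/-- The operator of a symmetric forest with `n` roots and `m` leaves, from functions on `Mⁿ` to
functions on `M^m`: apply at each vertex the isometry
`R_α : δ_x ↦ α δ_{branch false x} + β δ_{branch true x}`, the tensor factors at the end being
indexed by the labels of the leaves. As the map `(s, x) ↦ branch s x` is injective, `(R_α ξ)(y)` is
`α ξ(x)` for `y = branch false x`, it is `β ξ(x)` for `y = branch true x`, and `0` for all other `y`. -/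
def forestMap (α : ℝ) {X Y : SymForest} (p : X ⟶ Y) (ξ : (Fin X.width → Word) → ℂ) :
    (Fin Y.width → Word) → ℂ :=
  fun y => (forestWeight α p y : ℂ) * ξ (forestWord p y)

theorem forestMap_tsum (α : unitInterval) {X Y : SymForest} (p : X ⟶ Y)
    (ξ : (Fin X.width → Word) → ℂ) :
    ∑' y, ENNReal.ofReal (‖forestMap α p ξ y‖ ^ 2) = ∑' x, ENNReal.ofReal (‖ξ x‖ ^ 2) := by
  rw [← tsum_forest α _ p.tree p.isLabelling rfl fun x => ENNReal.ofReal (‖ξ x‖ ^ 2)]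
  refine tsum_congr fun y => ?_
  rw [← ENNReal.ofReal_mul (sq_nonneg _), forestMap, norm_mul, mul_pow,
    Complex.norm_real, Real.norm_eq_abs, sq_abs]
  rfl

theorem memlp_two_iff {A : Type} (ξ : A → ℂ) :
    Memℓp ξ 2 ↔ ∑' x, ENNReal.ofReal (‖ξ x‖ ^ 2) ≠ ∞ := by
  rw [memℓp_gen_iff (by norm_num)]
  simp only [ENNReal.toReal_ofNat, Real.rpow_two]
  constructor
  · intro h
    rw [← ENNReal.ofReal_tsum_of_nonneg (fun _ => sq_nonneg _) h]
    exact ENNReal.ofReal_ne_top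
  · intro h
    simpa [ENNReal.toReal_ofReal] using ENNReal.summable_toReal h

theorem norm_sq_eq {A : Type} (ξ : lp (fun _ : A => ℂ) 2) :
    ‖ξ‖ ^ 2 = (∑' x, ENNReal.ofReal (‖ξ x‖ ^ 2)).toReal := by
  have h := lp.norm_rpow_eq_tsum (p := 2) (by norm_num) ξ
  simp only [ENNReal.toReal_ofNat, Real.rpow_two] at h
  rw [h, ENNReal.tsum_toReal_eq fun _ => ENNReal.ofReal_ne_top]
  exact tsum_congr fun x => (ENNReal.toReal_ofReal (sq_nonneg _)).symm

/-- The isometry `Φ_α(p) : ℓ²(Mⁿ) → ℓ²(M^m)` of a symmetric forest `p`. -/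
def forestIsometry (α : unitInterval) {X Y : SymForest} (p : X ⟶ Y) :
    WordSpace X →ₗᵢ[ℂ] WordSpace Y where
  toFun ξ := ⟨forestMap α p ξ, (memlp_two_iff _).2 (by
    rw [forestMap_tsum]; exact (memlp_two_iff _).1 ξ.2)⟩
  map_add' ξ η := by
    ext y
    exact mul_add _ _ _
  map_smul' c ξ := by
    ext y
    exact mul_left_comm _ _ _
  norm_map' ξ := by
    rw [← sq_eq_sq₀ (norm_nonneg _) (norm_nonneg _), norm_sq_eq, norm_sq_eq]
    exact congrArg ENNReal.toReal (forestMap_tsum α p ξ)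

theorem forestMap_comp (α : ℝ) {X Y Z : SymForest} (p : X ⟶ Y) (q : Y ⟶ Z)
    (ξ : (Fin X.width → Word) → ℂ) :
    forestMap α (p ≫ q) ξ = forestMap α q (forestMap α p ξ) := by
  funext z
  have h1 : forestWord (p ≫ q) z = forestWord p (forestWord q z) :=
    funext fun i => rootWord_graft q.tree z (p.tree i)
  have h2 : forestWeight α (p ≫ q) z = forestWeight α q z * forestWeight α p (forestWord q z) := by
    simp only [forestWeight, SymForest.comp_tree, rootWeight_graft, Finset.prod_mul_distrib]
    rw [p.isLabelling.prod_prod, mul_comm]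
    rfl
  simp only [forestMap, h1, h2]
  push_cast
  ring

/-- The monoidal functor `Φ_α` with `Φ_α(1) = ℓ²(M)`, `Φ_α(Y) = R_α`, extended to symmetric forests by
letting permutations permute the tensor factors. -/
def wordFunctor (α : unitInterval) : HilbFunctor SymForest where
  space := WordSpace
  map := forestIsometry α
  map_id X ξ := by
    ext y
    change ((∏ i : Fin X.width, (1 : ℝ) : ℝ) : ℂ) * ξ y = ξ y
    simp
  map_comp p q ξ := Subtype.ext (forestMap_comp α p q ξ)

open Classical in
/-- The basis vector `δ_w` of `ℓ²(Mⁿ)`. -/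
def dirac {X : SymForest} (w : Fin X.width → Word) : WordSpace X := lp.single 2 w 1

/-- The tree `Y` with two leaves. -/
def caret : (⟨1⟩ : SymForest) ⟶ ⟨2⟩ where
  tree _ := .node (.leaf 0) (.leaf 1)
  isLabelling := by simp only [IsLabelling, leaves]; decide

open Classical in
theorem dirac_apply_aux {X : SymForest} (w y : Fin X.width → Word) :
    (dirac w : WordSpace X) y = if y = w then 1 else 0 := by
  rw [dirac, lp.single_apply, Pi.single_apply]

theorem dirac_apply {X : SymForest} (w y : Fin X.width → Word) [Decidable (y = w)] :
    (dirac w : WordSpace X) y = if y = w then 1 else 0 := by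
  rw [dirac_apply_aux]
  congr

theorem forestIsometry_apply (α : unitInterval) {X Y : SymForest} (p : X ⟶ Y) (ξ : WordSpace X)
    (y : Fin Y.width → Word) : forestIsometry α p ξ y =
      (forestWeight α p y : ℂ) * ξ (forestWord p y) := rfl

/-- `Φ_α(Y) = R_α`: `δ_x ↦ α δ_{branch false x} + β δ_{branch true x}`. -/
theorem forestIsometry_caret (α : unitInterval) (x : Word) :
    forestIsometry α caret (dirac fun _ => x) =
      ((α : ℝ) : ℂ) • (dirac ![(branch false x).1, (branch false x).2] : WordSpace ⟨2⟩) +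
      ((√(1 - (α : ℝ) ^ 2) : ℝ) : ℂ) •
        (dirac ![(branch true x).1, (branch true x).2] : WordSpace ⟨2⟩) := by
  classical
  have e : ∀ (y : Fin 2 → Word) (p : Word × Word), y = ![p.1, p.2] ↔ p = (y 0, y 1) := by
    intro y p
    constructor
    · rintro rfl; rfl
    · rintro rfl; funext i; fin_cases i <;> rfl
  ext y
  have hw : forestWeight α caret y = parentWeight α (y 0, y 1) := by
    change (∏ _i : Fin 1, parentWeight α (y 0, y 1) * (1 * 1)) = _
    simp
  have hx : (forestWord caret y = fun _ => x) ↔ parent (y 0, y 1) = x :=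
    ⟨fun h => congrFun h 0, fun h => funext fun _ => h⟩
  have d : ∀ s, (dirac ![(branch s x).1, (branch s x).2] : WordSpace ⟨2⟩) y =
      if branch s x = (y 0, y 1) then 1 else 0 := fun s =>
    (@dirac_apply ⟨2⟩ _ y (Classical.propDecidable _)).trans (if_congr (e y _) rfl rfl)
  have hl : (forestIsometry α caret (dirac fun _ => x) : WordSpace ⟨2⟩) y =
      (parentWeight α (y 0, y 1) : ℂ) * if parent (y 0, y 1) = x then 1 else 0 := by
    rw [← hw]
    exact (forestIsometry_apply α caret _ y).trans
      (congrArg _ ((dirac_apply _ _).trans (if_congr hx rfl rfl)))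
  have key : ((parentWeight α (y 0, y 1) : ℂ) * if parent (y 0, y 1) = x then 1 else 0) =
      ((α : ℝ) : ℂ) * (if branch false x = (y 0, y 1) then 1 else 0) +
      ((√(1 - (α : ℝ) ^ 2) : ℝ) : ℂ) * (if branch true x = (y 0, y 1) then 1 else 0) := by
    by_cases h : ∃ s x', branch s x' = (y 0, y 1)
    · obtain ⟨s, x', h⟩ := h
      have hb : ∀ s', branch s' x = (y 0, y 1) ↔ s' = s ∧ x = x' := fun s' =>
        ⟨fun h' => by
          have := @branch_injective (s', x) (s, x') (h'.trans h.symm)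
          simpa using this, fun h' => by rw [h'.1, h'.2, h]⟩
      simp only [hb]
      rw [← h, parent_branch, parentWeight_branch]
      by_cases hx : x = x'
      · subst hx
        cases s <;> simp [stateWeight]
      · simp [hx, Ne.symm hx]
    · push Not at h
      rw [parentWeight_eq_zero α h, if_neg (h _ _), if_neg (h _ _)]
      simp
  rw [← d, ← d] at key
  exact hl.trans key

/-- A permutation `σ`, as the symmetric forest of trivial trees whose `i`-th root is joined to
the label `σ i`. -/
def permutation {X : SymForest} (σ : Equiv.Perm (Fin X.width)) : X ⟶ X where
  tree i := .leaf (σ i)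
  isLabelling := by
    rw [IsLabelling, ← map_univ_val_equiv σ, map_univ_val]
    rfl

/-- Permutations act by permuting the tensor factors:
`x₁ ⊗ ⋯ ⊗ xₙ` is sent to the tensor whose `j`-th factor is `x_{σ⁻¹ j}`. -/
theorem forestIsometry_permutation (α : unitInterval) {X : SymForest}
    (σ : Equiv.Perm (Fin X.width)) (w : Fin X.width → Word) :
    forestIsometry α (permutation σ) (dirac w) = (dirac fun j => w (σ.symm j) : WordSpace X) := by
  classical
  ext y
  have h : forestWord (permutation σ) y = w ↔ y = fun j => w (σ.symm j) :=
    ⟨fun h => by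
      rw [← h]
      funext j
      exact congrArg y (σ.apply_symm_apply j).symm,
    fun h => by
      rw [h]
      funext i
      exact congrArg w (σ.symm_apply_apply i)⟩
  have hw : forestWeight α (permutation σ) y = 1 := Finset.prod_const_one
  rw [forestIsometry_apply, dirac_apply, dirac_apply, hw, Complex.ofReal_one, one_mul]
  exact if_congr h rfl rfl

/-- Thompson's group `V`: the group of fractions of the category of symmetric forests at the object `1`,
that is, the group of classes of pairs of symmetric trees with equally many leaves. -/
abbrev ThompsonV : Type := FractionGroup (⟨1⟩ : SymForest)

/-- `φ_α(v) = ⟨π_α(v)δ_e, δ_e⟩` for the Jones representation `π_α` of `V` given by `Φ_α`. -/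
def phi (α : unitInterval) : ThompsonV → ℂ :=
  (wordFunctor α).coefficient ⟨1⟩ (dirac fun _ => 1)

/-- Positive definite functions on a group (`0 ≤ z` says that `z` is real and nonnegative). -/
def IsPositiveDefinite {G : Type} [Group G] (φ : G → ℂ) : Prop :=
  ∀ (n : ℕ) (g : Fin n → G) (c : Fin n → ℂ),
    0 ≤ ∑ i, ∑ j, conj (c i) * c j * φ ((g i)⁻¹ * g j)

/-- Functions on a discrete group that vanish at infinity: for every `ε > 0` one has `|φ(g)| < ε` for
all but finitely many `g`. -/
def VanishesAtInfinity {G : Type} (φ : G → ℂ) : Prop := Tendsto φ cofinite (𝓝 0)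

/-- The Haagerup property of a discrete group: there is a net of positive definite functions vanishing
at infinity that converges pointwise to one. -/
def HaagerupProperty (G : Type) [Group G] : Prop :=
  ∃ (ι : Type) (_ : Preorder ι) (_ : IsDirectedOrder ι) (_ : Nonempty ι) (φ : ι → G → ℂ),
    (∀ i, IsPositiveDefinite (φ i)) ∧ (∀ i, VanishesAtInfinity (φ i)) ∧
    ∀ g, Tendsto (fun i => φ i g) atTop (𝓝 1)

end Forests
end Jones

end

/-! Here φ_α(t/s) = ⟨Φ(t)δ_e, Φ(s)δ_e⟩, as `coefficient_mk` shows. The squared coefficients of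
Φ(t)δ_e are the law of a random labelling of the leaves of t by words: start with e at the root and
let every vertex choose independently between its two branches, with probabilities α² and β². By
Cauchy–Schwarz, |φ_α(t/s)|² is at most the probability that such a labelling is also possible for s
(`norm_phi_sq_le_expect`).

Put γ = max(α², β²), which is < 1 for 0 < α < 1. A word remembers its history: deleting the last
letter gives the parent's word, and exchanging a_j and b_j at the end gives the sibling's word. So
prescribing the word at a leaf of depth d prescribes d choices and has probability at most γ^d
(`expect_word_eq_le`).

Let t/s be reduced and let (i, j) be a deepest caret of t. In s, the word at i is a function of the
word at any leaf j' below the sibling of i. If some such j' differs from j, this relation is foreign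
to t: it forces the word e at every vertex down to where the paths to i and j' part, and on both
children there; below that it prescribes the word at i in terms of the one at j'. Hence every vertex
above i costs a factor γ (`expect_repetition_le`). Otherwise the sibling of i in s is the leaf j. As
the caret is not common, its leaves occur in the opposite order in s, and the word at i must be
empty. In both cases |φ_α(t/s)|² ≤ γ^depth(t) (`norm_phi_sq_le`). Every element is a reduced
fraction (`exists_reduced_fraction`), and only finitely many have few leaves, so φ_α vanishes at
infinity.

For α → 1 all coefficients are nonnegative, and the all-empty labelling alone contributes a power of
α to φ_α(t/s), which is at most 1 (`exists_phi_eq_ofReal`). The functions φ_α with 0 < α < 1 then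
form the net required for the Haagerup property. -/

noncomputable section

namespace Jones

open scoped ENNReal


/-! ### Words, their last letters, and the two branches -/

/-- The word without its last letter. -/
def dropLetter (w : Word) : Word := FreeMonoid.ofList w.toList.dropLast

/-- The word in which the last letter `a_j` or `b_j` is replaced by `b_j` or `a_j`. -/
def swapLetter (w : Word) : Word :=
  FreeMonoid.ofList (w.toList.dropLast ++ (w.toList.getLast?.map Sum.swap).toList)

theorem word_cases (w : Word) : w = 1 ∨ ∃ (x : Word) (c : ℕ ⊕ ℕ), w = x * FreeMonoid.of c := by
  rcases List.eq_nil_or_concat w.toList with h | ⟨l, c, h⟩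
  · exact Or.inl (FreeMonoid.toList.injective h)
  · exact Or.inr ⟨FreeMonoid.ofList l, c, FreeMonoid.toList.injective (by simpa using h)⟩

theorem mul_of_ne_one (x : Word) (c : ℕ ⊕ ℕ) : x * FreeMonoid.of c ≠ 1 := fun h => by
  have h' : x.toList ++ [c] = ([] : List (ℕ ⊕ ℕ)) := congrArg FreeMonoid.toList h
  simp at h'

@[simp] theorem dropLetter_one : dropLetter 1 = 1 := rfl

@[simp] theorem swapLetter_one : swapLetter 1 = 1 := rfl

@[simp] theorem dropLetter_mul_of (x : Word) (c : ℕ ⊕ ℕ) : dropLetter (x * FreeMonoid.of c) = x := by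
  apply FreeMonoid.toList.injective
  simp [dropLetter]

@[simp] theorem swapLetter_mul_of (x : Word) (c : ℕ ⊕ ℕ) :
    swapLetter (x * FreeMonoid.of c) = x * FreeMonoid.of c.swap := by
  apply FreeMonoid.toList.injective
  simp [swapLetter]

theorem dropLetter_swapLetter (w : Word) : dropLetter (swapLetter w) = dropLetter w := by
  rcases word_cases w with rfl | ⟨x, c, rfl⟩ <;> simp

theorem length_swapLetter (w : Word) : (swapLetter w).length = w.length := by
  rcases word_cases w with rfl | ⟨x, c, rfl⟩ <;> simp

theorem eq_one_of_swapLetter_eq {w : Word} (h : swapLetter w = w) : w = 1 := by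
  rcases word_cases w with rfl | ⟨x, c, rfl⟩
  · rfl
  · rw [swapLetter_mul_of] at h
    have := FreeMonoid.of_injective (mul_left_cancel h)
    cases c <;> simp at this

theorem length_dropLetter (w : Word) : (dropLetter w).length = w.length - 1 := by
  rcases word_cases w with rfl | ⟨x, c, rfl⟩ <;> simp

theorem length_dropLetter_iterate (n : ℕ) (w : Word) :
    (dropLetter^[n] w).length = w.length - n := by
  induction n with
  | zero => rfl
  | succ n ih => rw [Function.iterate_succ_apply', length_dropLetter, ih]; omega

/-- Since p ≥ 1, deleting p letters of u removes the swap in `h'`, so a truncation of w equals the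
swap of another truncation of w. Comparing lengths, the two truncations coincide or are empty, and
only the empty word is fixed by the swap. For p = 0 the hypotheses can express the ordinary relation
between siblings, which forces nothing. -/
theorem eq_one_of_dropLetter_iterate {p q k : ℕ} {u w : Word} (hp : p ≠ 0)
    (h : dropLetter^[p] u = swapLetter (dropLetter^[q] w))
    (h' : u = swapLetter (dropLetter^[k] w)) : dropLetter^[q] w = 1 := by
  obtain ⟨p, rfl⟩ := Nat.exists_eq_succ_of_ne_zero hp
  have e : dropLetter^[p + 1 + k] w = swapLetter (dropLetter^[q] w) := by
    rw [← h, h', Function.iterate_succ_apply, dropLetter_swapLetter,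
      ← Function.iterate_succ_apply (f := dropLetter), ← Function.iterate_add_apply]
  have hl := congrArg FreeMonoid.length e
  rw [length_swapLetter, length_dropLetter_iterate, length_dropLetter_iterate] at hl
  -- Lengths are truncated differences, so they determine the exponent only if q is smaller than the
  -- length of w.
  by_cases hq : w.length ≤ q
  · apply FreeMonoid.length_eq_zero.1
    rw [length_dropLetter_iterate]; omega
  · obtain rfl : p + 1 + k = q := by omega
    exact eq_one_of_swapLetter_eq e.symm

theorem branch_eq (s : Bool) (x : Word) : branch s x = (1, 1) ∧ x = 1 ∧ s = false ∨
    ∃ j, branch s x = (x * genA j, x * genB j) := by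
  unfold branch
  by_cases hx : x = 1
  · cases s
    · exact Or.inl ⟨by simp [hx], hx, rfl⟩
    · exact Or.inr ⟨0, by simp [hx]⟩
  · exact Or.inr ⟨_, if_neg hx⟩

@[simp] theorem branch_false_one : branch false 1 = (1, 1) := by simp [branch]

@[simp] theorem branch_true_one : branch true 1 = (genA 0, genB 0) := by simp [branch]

theorem dropLetter_branch_fst (s : Bool) (x : Word) : dropLetter (branch s x).1 = x := by
  rcases branch_eq s x with ⟨h, rfl, -⟩ | ⟨j, h⟩ <;> rw [h] <;> simp [genA]

theorem dropLetter_branch_snd (s : Bool) (x : Word) : dropLetter (branch s x).2 = x := by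
  rcases branch_eq s x with ⟨h, rfl, -⟩ | ⟨j, h⟩ <;> rw [h] <;> simp [genB]

theorem swapLetter_branch_fst (s : Bool) (x : Word) :
    swapLetter (branch s x).1 = (branch s x).2 := by
  rcases branch_eq s x with ⟨h, rfl, -⟩ | ⟨j, h⟩ <;> rw [h] <;> simp [genA, genB]

theorem swapLetter_branch_snd (s : Bool) (x : Word) :
    swapLetter (branch s x).2 = (branch s x).1 := by
  rcases branch_eq s x with ⟨h, rfl, -⟩ | ⟨j, h⟩ <;> rw [h] <;> simp [genA, genB]

/-- One component determines the other by the swap, so `branch_injective` applies. Thus the word at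
a single child already reveals the choice made at the vertex. -/
theorem branch_fst_injective {s s' : Bool} {x : Word} (h : (branch s x).1 = (branch s' x).1) :
    s = s' := by
  have h2 : branch s x = branch s' x := Prod.ext h (by
    rw [← swapLetter_branch_fst, h, swapLetter_branch_fst])
  exact congrArg Prod.fst (@branch_injective (s, x) (s', x) h2)

theorem branch_snd_injective {s s' : Bool} {x : Word} (h : (branch s x).2 = (branch s' x).2) :
    s = s' :=
  branch_fst_injective (by rw [← swapLetter_branch_snd, h, swapLetter_branch_snd])

/-- A nonempty left component ends in some a_j and a nonempty right one in some b_j. -/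
theorem eq_one_of_branch_swapped {s s' : Bool} {x x' : Word}
    (h : (branch s x).1 = (branch s' x').2) : (branch s x).1 = 1 := by
  rcases branch_eq s x with ⟨h1, -⟩ | ⟨j, h1⟩
  · rw [h1]
  rcases branch_eq s' x' with ⟨h2, -⟩ | ⟨j', h2⟩
  · rw [h, h2]
  rw [h1, h2] at h
  have h3 : x.toList ++ [Sum.inl j] = x'.toList ++ [Sum.inr j'] := congrArg FreeMonoid.toList h
  have h4 := (List.append_inj' h3 rfl).2
  simp at h4

/-! ### Subtrees, siblings and the size of trees -/

section Trees

variable {J : Type}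

/-- `SubtreeAt u k t`: the tree `u` is the subtree of `t` at some vertex of depth `k`. -/
inductive SubtreeAt (u : BinTree J) : ℕ → BinTree J → Prop
  | refl : SubtreeAt u 0 u
  | left {k : ℕ} {l r : BinTree J} : SubtreeAt u k l → SubtreeAt u (k + 1) (.node l r)
  | right {k : ℕ} {l r : BinTree J} : SubtreeAt u k r → SubtreeAt u (k + 1) (.node l r)

theorem SubtreeAt.trans {u v t : BinTree J} {k m : ℕ} (h : SubtreeAt u k v)
    (h' : SubtreeAt v m t) : SubtreeAt u (k + m) t := by
  induction h' with
  | refl => exact h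
  | left _ ih => exact ih.left
  | right _ ih => exact ih.right

theorem SubtreeAt.leaves_le {u t : BinTree J} {k : ℕ} (h : SubtreeAt u k t) :
    leaves u ≤ leaves t := by
  induction h with
  | refl => exact le_rfl
  | left _ ih => exact ih.trans (Multiset.le_add_right _ _)
  | right _ ih => exact ih.trans (Multiset.le_add_left _ _)

theorem exists_subtreeAt_leaf {t : BinTree J} {j : J} (h : j ∈ leaves t) :
    ∃ k, SubtreeAt (.leaf j) k t := by
  induction t with
  | leaf j' =>
    obtain rfl : j = j' := by simpa [leaves] using h
    exact ⟨0, .refl⟩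
  | node l r hl hr =>
    rcases Multiset.mem_add.1 h with h | h
    · obtain ⟨k, hk⟩ := hl h; exact ⟨_, hk.left⟩
    · obtain ⟨k, hk⟩ := hr h; exact ⟨_, hk.right⟩

/-- A vertex of maximal depth among the inner ones has two leaves as children. Maximality makes the
exponent in the final bound the full depth of the tree. -/
theorem exists_deepest_caret (t : BinTree J) (ht : depth t ≠ 0) :
    ∃ i j, SubtreeAt (.node (.leaf i) (.leaf j)) (depth t - 1) t := by
  induction t with
  | leaf j => exact absurd rfl ht
  | node l r hl hr =>
    by_cases h0 : depth l = 0 ∧ depth r = 0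
    · cases l with
      | node _ _ => simp [depth] at h0
      | leaf i =>
        cases r with
        | node _ _ => simp [depth] at h0
        | leaf j => exact ⟨i, j, .refl⟩
    · rcases le_total (depth r) (depth l) with h | h
      · obtain ⟨i, j, hij⟩ := hl (by omega)
        refine ⟨i, j, ?_⟩
        have := hij.left (r := r)
        rwa [show depth l - 1 + 1 = depth (.node l r) - 1 by simp only [depth]; omega] at this
      · obtain ⟨i, j, hij⟩ := hr (by omega)
        refine ⟨i, j, ?_⟩
        have := hij.right (l := l)
        rwa [show depth r - 1 + 1 = depth (.node l r) - 1 by simp only [depth]; omega] at this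

/-- `u` and `v` are the two subtrees below a vertex of `t`. -/
def AreSiblings (u v t : BinTree J) : Prop :=
  ∃ k, SubtreeAt (.node u v) k t ∨ SubtreeAt (.node v u) k t

theorem AreSiblings.disjoint {u v t : BinTree J} (h : AreSiblings u v t)
    (ht : (leaves t).Nodup) : (leaves v).Nodup ∧ Disjoint (leaves u) (leaves v) := by
  obtain ⟨k, h | h⟩ := h
  · exact (Multiset.nodup_add.1 (Multiset.nodup_of_le h.leaves_le ht)).2
  · obtain ⟨h1, -, h3⟩ := Multiset.nodup_add.1 (Multiset.nodup_of_le h.leaves_le ht)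
    exact ⟨h1, h3.symm⟩

theorem exists_sibling {t : BinTree J} {j : J} (h : j ∈ leaves t) (ht : depth t ≠ 0) :
    ∃ u, AreSiblings (.leaf j) u t := by
  induction t with
  | leaf _ => exact absurd rfl ht
  | node l r hl hr =>
    rcases Multiset.mem_add.1 h with h | h
    · cases l with
      | leaf j' =>
        obtain rfl : j = j' := by simpa [leaves] using h
        exact ⟨r, 0, Or.inl .refl⟩
      | node l₁ l₂ =>
        obtain ⟨u, k, hu⟩ := hl h (by simp [depth])
        exact ⟨u, k + 1, hu.imp .left .left⟩
    · cases r with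
      | leaf j' =>
        obtain rfl : j = j' := by simpa [leaves] using h
        exact ⟨l, 0, Or.inr .refl⟩
      | node r₁ r₂ =>
        obtain ⟨u, k, hu⟩ := hr h (by simp [depth])
        exact ⟨u, k + 1, hu.imp .right .right⟩

theorem card_leaves_pos (t : BinTree J) : 0 < Multiset.card (leaves t) := by
  induction t with
  | leaf j => simp [leaves]
  | node l r hl hr => simp only [leaves, Multiset.card_add]; omega

theorem eq_leaf_of_forall_mem_leaves {t : BinTree J} (ht : (leaves t).Nodup) {j : J}
    (h : ∀ j' ∈ leaves t, j' = j) : t = .leaf j := by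
  cases t with
  | leaf j' => rw [h j' (by simp [leaves])]
  | node l r =>
    obtain ⟨a, ha⟩ := Multiset.card_pos_iff_exists_mem.1 (card_leaves_pos l)
    obtain ⟨b, hb⟩ := Multiset.card_pos_iff_exists_mem.1 (card_leaves_pos r)
    have e : a = b := (h a (Multiset.mem_add.2 (Or.inl ha))).trans
      (h b (Multiset.mem_add.2 (Or.inr hb))).symm
    exact absurd hb (e ▸ Multiset.disjoint_left.1 (Multiset.nodup_add.1 ht).2.2 ha)

theorem depth_lt_card_leaves (t : BinTree J) : depth t < Multiset.card (leaves t) := by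
  induction t with
  | leaf j => simp [leaves, depth]
  | node l r hl hr => simp only [leaves, depth, Multiset.card_add]; omega

theorem card_leaves_le (t : BinTree J) : Multiset.card (leaves t) ≤ 2 ^ depth t := by
  induction t with
  | leaf j => simp [leaves, depth]
  | node l r hl hr =>
    simp only [leaves, depth, Multiset.card_add, pow_succ, mul_two]
    exact add_le_add (hl.trans (Nat.pow_le_pow_right two_pos (le_max_left _ _)))
      (hr.trans (Nat.pow_le_pow_right two_pos (le_max_right _ _)))

theorem finite_setOf_depth_le [Finite J] (d : ℕ) : {t : BinTree J | depth t ≤ d}.Finite := by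
  induction d with
  | zero =>
    refine (Set.finite_range BinTree.leaf).subset fun t ht => ?_
    cases t with
    | leaf j => exact ⟨j, rfl⟩
    | node l r => simp [depth] at ht
  | succ d ih =>
    refine ((Set.finite_range BinTree.leaf).union (Set.Finite.image2 BinTree.node ih ih)).subset
      fun t ht => ?_
    cases t with
    | leaf j => exact Or.inl ⟨j, rfl⟩
    | node l r =>
      have h : max (depth l) (depth r) ≤ d := Nat.le_of_succ_le_succ ht
      exact Or.inr ⟨l, (le_max_left _ _).trans h, r, (le_max_right _ _).trans h, rfl⟩

/-! ### Relations between the leaf words of an admissible labelling -/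

/-- The tensor of the words `y` at the leaves of `t` occurs in the image of `δ_x` under `t`. -/
def Admissible : BinTree J → Word → (J → Word) → Prop
  | .leaf j, x, y => y j = x
  | .node l r, x, y => ∃ s, Admissible l (branch s x).1 y ∧ Admissible r (branch s x).2 y

theorem Admissible.congr {t : BinTree J} {x : Word} {y y' : J → Word} (h : Admissible t x y)
    (hy : ∀ j ∈ leaves t, y j = y' j) : Admissible t x y' := by
  induction t generalizing x with
  | leaf j => exact (hy j (by simp [leaves])).symm.trans h
  | node l r hl hr =>
    obtain ⟨s, h1, h2⟩ := h
    exact ⟨s, hl h1 fun j hj => hy j (Multiset.mem_add.2 (Or.inl hj)),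
      hr h2 fun j hj => hy j (Multiset.mem_add.2 (Or.inr hj))⟩

theorem admissible_of_rootWeight_ne_zero {α : ℝ} {t : BinTree J} {y : J → Word}
    (h : rootWeight α y t ≠ 0) : Admissible t (rootWord y t) y := by
  induction t with
  | leaf j => rfl
  | node l r hl hr =>
    simp only [rootWeight, ne_eq, mul_eq_zero, not_or] at h
    by_cases hb : ∃ s x, branch s x = (rootWord y l, rootWord y r)
    · obtain ⟨s, x, hb⟩ := hb
      refine ⟨s, ?_⟩
      rw [rootWord, ← hb, parent_branch, hb]
      exact ⟨hl h.2.1, hr h.2.2⟩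
    · push Not at hb
      exact absurd (parentWeight_eq_zero α hb) h.1

/-- Passing to a child appends one letter or keeps the empty word; `dropLetter` undoes both. -/
theorem Admissible.subtreeAt {u t : BinTree J} {k : ℕ} (h : SubtreeAt u k t) {x : Word}
    {y : J → Word} (ha : Admissible t x y) : ∃ x', Admissible u x' y ∧ dropLetter^[k] x' = x := by
  induction h generalizing x with
  | refl => exact ⟨x, ha, rfl⟩
  | left _ ih =>
    obtain ⟨s, h1, -⟩ := ha
    obtain ⟨x', hx', e⟩ := ih h1
    exact ⟨x', hx', by rw [Function.iterate_succ_apply', e, dropLetter_branch_fst]⟩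
  | right _ ih =>
    obtain ⟨s, -, h1⟩ := ha
    obtain ⟨x', hx', e⟩ := ih h1
    exact ⟨x', hx', by rw [Function.iterate_succ_apply', e, dropLetter_branch_snd]⟩

theorem Admissible.leaf_word {t : BinTree J} {k : ℕ} {j : J} (h : SubtreeAt (.leaf j) k t)
    {x : Word} {y : J → Word} (ha : Admissible t x y) : dropLetter^[k] (y j) = x := by
  obtain ⟨x', hx', e⟩ := ha.subtreeAt h
  rw [← e]
  exact congrArg _ hx'

/-- Truncating the word at j recovers the word at the root of u, whose swap is the word at the
sibling i. This is the relation that s imposes on the labellings of t. -/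
theorem Admissible.sibling_word {t u : BinTree J} {i j : J} {k : ℕ}
    (hs : AreSiblings (.leaf i) u t) (hj : SubtreeAt (.leaf j) k u) {x : Word} {y : J → Word}
    (ha : Admissible t x y) : y i = swapLetter (dropLetter^[k] (y j)) := by
  obtain ⟨m, h | h⟩ := hs
  · obtain ⟨x', ⟨s, h1, h2⟩, -⟩ := ha.subtreeAt h
    rw [h2.leaf_word hj, swapLetter_branch_snd]
    exact h1
  · obtain ⟨x', ⟨s, h2, h1⟩, -⟩ := ha.subtreeAt h
    rw [h2.leaf_word hj, swapLetter_branch_fst]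
    exact h1

theorem Admissible.eq_one_of_swapped_carets {t s : BinTree J} {i j : J} {k m : ℕ}
    (ht : SubtreeAt (.node (.leaf i) (.leaf j)) k t)
    (hs : SubtreeAt (.node (.leaf j) (.leaf i)) m s) {x x' : Word} {y : J → Word}
    (hat : Admissible t x y) (has : Admissible s x' y) : y i = 1 := by
  obtain ⟨u, ⟨b, h1, -⟩, -⟩ := hat.subtreeAt ht
  obtain ⟨u', ⟨b', -, h2⟩, -⟩ := has.subtreeAt hs
  change y i = _ at h1 h2
  rw [h1]
  exact eq_one_of_branch_swapped (h1.symm.trans h2)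

/-- Because j' lies off the caret, the paths to i and j' part strictly above it. At the parting
vertex the children's words are swaps of each other and truncations of y i and y j', so
`eq_one_of_dropLetter_iterate` makes them empty; then all words above are empty too. -/
theorem Admissible.eq_one_of_repetition {t : BinTree J} {i j j' : J} {c k : ℕ}
    (hc : SubtreeAt (.node (.leaf i) (.leaf j)) c t) (hj' : j' ∈ leaves t) (hi : j' ≠ i)
    (hj : j' ≠ j) {x : Word} {y : J → Word} (ha : Admissible t x y)
    (hy : y i = swapLetter (dropLetter^[k] (y j'))) : x = 1 := by
  induction hc generalizing x with
  | refl => simp [leaves, hi, hj] at hj'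
  | @left c l r hc ih =>
    obtain ⟨s, h1, h2⟩ := ha
    rw [← dropLetter_branch_fst s x]
    rcases Multiset.mem_add.1 hj' with h | h
    · rw [ih h h1, dropLetter_one]
    · obtain ⟨q, hq⟩ := exists_subtreeAt_leaf h
      have e1 := h1.leaf_word ((SubtreeAt.left .refl).trans hc)
      have e2 := h2.leaf_word hq
      -- The leaf i lies one level below its caret, hence c + 1 ≥ 1 levels below the root of l.
      have := eq_one_of_dropLetter_iterate (p := 0 + 1 + c) (by omega)
        (by rw [e1, e2, swapLetter_branch_snd]) hy
      rw [← swapLetter_branch_snd, ← e2, this, swapLetter_one, dropLetter_one]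
  | @right c l r hc ih =>
    obtain ⟨s, h2, h1⟩ := ha
    rw [← dropLetter_branch_snd s x]
    rcases Multiset.mem_add.1 hj' with h | h
    · obtain ⟨q, hq⟩ := exists_subtreeAt_leaf h
      have e1 := h1.leaf_word ((SubtreeAt.left .refl).trans hc)
      have e2 := h2.leaf_word hq
      have := eq_one_of_dropLetter_iterate (p := 0 + 1 + c) (by omega)
        (by rw [e1, e2, swapLetter_branch_fst]) hy
      rw [← swapLetter_branch_fst, ← e2, this, swapLetter_one, dropLetter_one]
    · rw [ih h h1, dropLetter_one]

end Trees


/-! ### Expectations over random labellings -/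

section Expectation

variable {J : Type} [DecidableEq J] {P : Bool → ℝ≥0∞}

/-- The expectation of `f` at the words which random states put at the leaves of `t` when the word at
the root is `x`; each vertex has the state `s` with probability `P s`. The words at labels that do not
occur in `t` are kept. -/
def expect (P : Bool → ℝ≥0∞) :
    BinTree J → Word → ((J → Word) → ℝ≥0∞) → (J → Word) → ℝ≥0∞
  | .leaf j, x, f => fun y => f (Function.update y j x)
  | .node l r, x, f => fun y =>
      P false * expect P l (branch false x).1 (expect P r (branch false x).2 f) y +
        P true * expect P l (branch true x).1 (expect P r (branch true x).2 f) y

theorem expect_const (hP : P false + P true = 1) (t : BinTree J) (x : Word) (c : ℝ≥0∞) :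
    expect P t x (fun _ => c) = fun _ => c := by
  induction t generalizing x with
  | leaf j => rfl
  | node l r hl hr =>
    funext y
    simp only [expect, hl, hr]
    rw [← add_mul, hP, one_mul]

theorem expect_const_mul (t : BinTree J) (x : Word) (c : ℝ≥0∞) (f : (J → Word) → ℝ≥0∞) :
    expect P t x (fun y => c * f y) = fun y => c * expect P t x f y := by
  induction t generalizing x f with
  | leaf j => rfl
  | node l r hl hr =>
    funext y
    simp only [expect, hl, hr]
    ring

theorem expect_add (t : BinTree J) (x : Word) (f g : (J → Word) → ℝ≥0∞) :
    expect P t x (fun y => f y + g y) = fun y => expect P t x f y + expect P t x g y := by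
  induction t generalizing x f g with
  | leaf j => rfl
  | node l r hl hr =>
    funext y
    simp only [expect, hl, hr]
    ring

theorem expect_tsum {A : Type} (t : BinTree J) (x : Word) (f : A → (J → Word) → ℝ≥0∞) :
    expect P t x (fun y => ∑' a, f a y) = fun y => ∑' a, expect P t x (f a) y := by
  induction t generalizing x f with
  | leaf j => rfl
  | node l r hl hr =>
    funext y
    simp only [expect, hl, hr, ENNReal.tsum_add, ENNReal.tsum_mul_left]

/-- Fubini: the two trees overwrite disjoint sets of labels. -/
theorem expect_comm (l r : BinTree J) (h : Disjoint (leaves l) (leaves r)) (x x' : Word)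
    (f : (J → Word) → ℝ≥0∞) : expect P l x (expect P r x' f) = expect P r x' (expect P l x f) := by
  induction l generalizing x x' f with
  | leaf j =>
    induction r generalizing x' f with
    | leaf j' =>
      have hne : j ≠ j' := by simpa [leaves, eq_comm] using h
      funext y
      simp only [expect, Function.update_comm hne]
    | node r₁ r₂ h1 h2 =>
      have h3 := Multiset.disjoint_add_right.1 h
      simp only [expect] at h1 h2 ⊢
      funext y
      rw [← h2 h3.2, ← h2 h3.2, ← h1 h3.1, ← h1 h3.1]
  | node l₁ l₂ h1 h2 =>
    have h3 := Multiset.disjoint_add_left.1 h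
    simp only [expect, expect_add, expect_const_mul, h1 h3.1, h2 h3.2]

/-- The random labelling is always admissible and leaves the labels outside t untouched, so a
comparison is needed only there. -/
theorem expect_mono {t : BinTree J} (ht : (leaves t).Nodup) {x : Word}
    {f g : (J → Word) → ℝ≥0∞} {y₀ : J → Word}
    (h : ∀ y, Admissible t x y → (∀ j ∉ leaves t, y j = y₀ j) → f y ≤ g y) :
    expect P t x f y₀ ≤ expect P t x g y₀ := by
  induction t generalizing x f g y₀ with
  | leaf j =>
    refine h _ (Function.update_self _ _ _) fun j' hj' => Function.update_of_ne ?_ _ _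
    simpa [leaves] using hj'
  | node l r hl hr =>
    obtain ⟨nl, nr, hd⟩ := Multiset.nodup_add.1 ht
    have key : ∀ s, expect P l (branch s x).1 (expect P r (branch s x).2 f) y₀ ≤
        expect P l (branch s x).1 (expect P r (branch s x).2 g) y₀ := fun s =>
      hl nl fun y' ha' he' => hr nr fun y ha he =>
        h y ⟨s, ha'.congr fun j hj => (he j (Multiset.disjoint_left.1 hd hj)).symm, ha⟩
          fun j hj => by
            have h1 : j ∉ leaves l := fun h1 => hj (Multiset.mem_add.2 (Or.inl h1))
            have h2 : j ∉ leaves r := fun h2 => hj (Multiset.mem_add.2 (Or.inr h2))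
            rw [he j h2, he' j h1]
    exact add_le_add (mul_le_mul_right (key false) _) (mul_le_mul_right (key true) _)

theorem expect_congr {t : BinTree J} (ht : (leaves t).Nodup) {x : Word}
    {f g : (J → Word) → ℝ≥0∞} {y₀ : J → Word}
    (h : ∀ y, Admissible t x y → (∀ j ∉ leaves t, y j = y₀ j) → f y = g y) :
    expect P t x f y₀ = expect P t x g y₀ :=
  le_antisymm (expect_mono ht fun y h1 h2 => (h y h1 h2).le)
    (expect_mono ht fun y h1 h2 => (h y h1 h2).ge)

theorem expect_le_const (hP : P false + P true = 1) {t : BinTree J} (ht : (leaves t).Nodup)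
    {x : Word} {f : (J → Word) → ℝ≥0∞} {y₀ : J → Word} {c : ℝ≥0∞}
    (h : ∀ y, Admissible t x y → (∀ j ∉ leaves t, y j = y₀ j) → f y ≤ c) :
    expect P t x f y₀ ≤ c :=
  (expect_mono (g := fun _ => c) ht h).trans (congrFun (expect_const hP t x c) y₀).le

theorem expect_eq_zero (hP : P false + P true = 1) {t : BinTree J} (ht : (leaves t).Nodup)
    {x : Word} {f : (J → Word) → ℝ≥0∞} {y₀ : J → Word}
    (h : ∀ y, Admissible t x y → (∀ j ∉ leaves t, y j = y₀ j) → f y = 0) :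
    expect P t x f y₀ = 0 :=
  le_antisymm (expect_le_const hP ht fun y h1 h2 => (h y h1 h2).le) zero_le

theorem expect_eq_self (hP : P false + P true = 1) {t : BinTree J} (ht : (leaves t).Nodup)
    {x : Word} {f : (J → Word) → ℝ≥0∞} {y₀ : J → Word}
    (h : ∀ y, (∀ j ∉ leaves t, y j = y₀ j) → f y = f y₀) :
    expect P t x f y₀ = f y₀ :=
  (expect_congr (g := fun _ => f y₀) ht fun y _ h2 => h y h2).trans
    (congrFun (expect_const hP t x _) y₀)

variable {γ : ℝ≥0∞}

-- The word w at i determines by truncation every word on the path from the root to i, hence the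
-- choice at each of its k vertices. Each choice has probability at most γ.
open Classical in
theorem expect_word_eq_le (hP : P false + P true = 1) (hγ : ∀ s, P s ≤ γ) {t : BinTree J}
    (ht : (leaves t).Nodup) {i : J} {k : ℕ} (hi : SubtreeAt (.leaf i) k t) (x w : Word)
    (y₀ : J → Word) : expect P t x (fun y => if y i = w then 1 else 0) y₀ ≤ γ ^ k := by
  -- If only one of the two states contributes, the vertex costs a factor γ.
  have sum_le : ∀ (a : Bool → ℝ≥0∞) (c : ℝ≥0∞) (b : Bool), a (!b) = 0 → a b ≤ c →
      P false * a false + P true * a true ≤ γ * c := by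
    intro a c b h0 h1
    cases b
    · simp only [Bool.not_false] at h0
      rw [h0, mul_zero, add_zero]
      exact mul_le_mul' (hγ _) h1
    · simp only [Bool.not_true] at h0
      rw [h0, mul_zero, zero_add]
      exact mul_le_mul' (hγ _) h1
  induction hi generalizing x w y₀ with
  | refl =>
    rw [pow_zero]
    exact expect_le_const hP ht fun y _ _ => by split_ifs <;> simp
  | @left k l r hi ih =>
    obtain ⟨nl, nr, hd⟩ := Multiset.nodup_add.1 ht
    have hmem : i ∈ leaves l := Multiset.mem_of_le hi.leaves_le (by simp [leaves])
    have e : ∀ x', expect P r x' (fun y => if y i = w then 1 else 0) =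
        fun y => if y i = w then 1 else 0 := fun x' => funext fun y =>
      expect_eq_self hP nr fun y' hy' => by rw [hy' i (Multiset.disjoint_left.1 hd hmem)]
    have hz : ∀ s, (branch s x).1 ≠ dropLetter^[k] w →
        expect P l (branch s x).1 (fun y => if y i = w then 1 else 0) y₀ = 0 := fun s hs =>
      expect_eq_zero hP nl fun y hy _ => if_neg fun h => hs (by rw [← hy.leaf_word hi, h])
    simp only [expect, e, pow_succ']
    obtain ⟨b, hb⟩ : ∃ b, (branch (!b) x).1 ≠ dropLetter^[k] w := by
      by_contra! h
      have := branch_fst_injective ((h false).trans (h true).symm)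
      simp at this
    exact sum_le (fun s => expect P l (branch s x).1 (fun y => if y i = w then 1 else 0) y₀)
      _ b (hz _ hb) (ih nl _ _ _)
  | @right k l r hi ih =>
    obtain ⟨nl, nr, hd⟩ := Multiset.nodup_add.1 ht
    have hz : ∀ s, (branch s x).2 ≠ dropLetter^[k] w →
        expect P r (branch s x).2 (fun y => if y i = w then 1 else 0) = fun _ => 0 := fun s hs =>
      funext fun y' =>
        expect_eq_zero hP nr fun y hy _ => if_neg fun h => hs (by rw [← hy.leaf_word hi, h])
    simp only [expect, pow_succ']
    obtain ⟨b, hb⟩ : ∃ b, (branch (!b) x).2 ≠ dropLetter^[k] w := by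
      by_contra! h
      have := branch_snd_injective ((h false).trans (h true).symm)
      simp at this
    refine sum_le (fun s => expect P l (branch s x).1
      (expect P r (branch s x).2 (fun y => if y i = w then 1 else 0)) y₀) _ b ?_
      (expect_le_const hP nl fun y' _ _ => ih nr _ _ _)
    simp only [hz _ hb, expect_const hP]

-- Induction along the path to the caret, with the empty word at the root. While i and j' lie in the
-- same subtree, only the state `false` survives and costs a factor γ. At the parting vertex it
-- survives as well, and below it the words at i and j' are independent: conditioning on y j' leaves
-- a single possible word at i.
open Classical in
theorem expect_repetition_le (hP : P false + P true = 1) (hγ : ∀ s, P s ≤ γ) {t : BinTree J}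
    (ht : (leaves t).Nodup) {i j j' : J} {c k : ℕ}
    (hc : SubtreeAt (.node (.leaf i) (.leaf j)) c t) (hj' : j' ∈ leaves t) (hi : j' ≠ i)
    (hj : j' ≠ j) (y₀ : J → Word) :
    expect P t 1 (fun y => if y i = swapLetter (dropLetter^[k] (y j')) then 1 else 0) y₀ ≤
      γ ^ (c + 1) := by
  set f : (J → Word) → ℝ≥0∞ :=
    fun y => if y i = swapLetter (dropLetter^[k] (y j')) then 1 else 0 with hf
  have fixed : ∀ {u : BinTree J} (_ : (leaves u).Nodup) (_ : i ∉ leaves u) (_ : j' ∉ leaves u)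
      (x : Word), expect P u x f = f := fun nu h1 h2 x => funext fun y =>
    expect_eq_self hP nu fun y' hy' => by simp only [hf, hy' i h1, hy' j' h2]
  -- Once j' lies outside u, the word y j' is a constant and the relation prescribes the word at i.
  have frozen : ∀ {u : BinTree J} {m : ℕ} (_ : (leaves u).Nodup) (_ : SubtreeAt (.leaf i) m u)
      (_ : j' ∉ leaves u) (x : Word) (y : J → Word), expect P u x f y ≤ γ ^ m :=
    fun nu h1 h2 x y => (expect_congr nu fun y' _ hy' => by
      simp only [hf, hy' j' h2]; rfl).trans_le (expect_word_eq_le hP hγ nu h1 x _ y)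
  have leaf_mem : ∀ {t : BinTree J} {c : ℕ} (_ : SubtreeAt (.node (.leaf i) (.leaf j)) c t),
      i ∈ leaves t := fun hc => Multiset.mem_of_le hc.leaves_le (by simp [leaves])
  have step : ∀ {l r : BinTree J} {c : ℕ} (_ : (leaves (.node l r)).Nodup)
      (_ : SubtreeAt (.node (.leaf i) (.leaf j)) c (.node l r)) (_ : j' ∈ leaves (.node l r))
      (b : ℝ≥0∞) (y : J → Word) (_ : expect P l 1 (expect P r 1 f) y ≤ b),
      expect P (.node l r) 1 f y ≤ γ * b := by
    intro l r c nt hc hj' b y hb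
    -- In the state `true` the children carry a₀ and b₀, whereas the relation would force an empty
    -- word on them.
    have hz : expect P l (genA 0) (expect P r (genB 0) f) y = 0 := by
      obtain ⟨nl, nr, hd⟩ := Multiset.nodup_add.1 nt
      refine expect_eq_zero hP nl fun y' ha' _ => expect_eq_zero hP nr fun y ha he => if_neg ?_
      intro h
      have ha2 : Admissible l (genA 0) y :=
        ha'.congr fun j hj => (he j (Multiset.disjoint_left.1 hd hj)).symm
      cases hc with
      | refl =>
        rcases Multiset.mem_add.1 hj' with h | h <;> simp [leaves, hi, hj] at h
      | left hc =>
        rcases Multiset.mem_add.1 hj' with hm | hm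
        · exact genA_ne_one 0 (ha2.eq_one_of_repetition hc hm hi hj h)
        · obtain ⟨q, hq⟩ := exists_subtreeAt_leaf hm
          have e1 := ha2.leaf_word ((SubtreeAt.left .refl).trans hc)
          have e2 := ha.leaf_word hq
          have := eq_one_of_dropLetter_iterate (p := 0 + 1 + _) (by omega) (by rw [e1, e2]; rfl) h
          rw [e2] at this
          exact mul_of_ne_one 1 (Sum.inr 0) ((one_mul _).trans this)
      | right hc =>
        rcases Multiset.mem_add.1 hj' with hm | hm
        · obtain ⟨q, hq⟩ := exists_subtreeAt_leaf hm
          have e1 := ha.leaf_word ((SubtreeAt.left .refl).trans hc)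
          have e2 := ha2.leaf_word hq
          have := eq_one_of_dropLetter_iterate (p := 0 + 1 + _) (by omega) (by rw [e1, e2]; rfl) h
          rw [e2] at this
          exact genA_ne_one 0 this
        · exact mul_of_ne_one 1 (Sum.inr 0) ((one_mul _).trans
            (ha.eq_one_of_repetition hc hm hi hj h))
    simp only [expect, branch_false_one, branch_true_one, hz, mul_zero, add_zero]
    exact mul_le_mul' (hγ _) hb
  clear_value f
  induction hc generalizing y₀ with
  | refl => simp [leaves, hi, hj] at hj'
  | @left c l r hc ih =>
    obtain ⟨nl, nr, hd⟩ := Multiset.nodup_add.1 ht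
    have h1 : ∀ {a}, a ∈ leaves l → a ∉ leaves r := fun h => Multiset.disjoint_left.1 hd h
    rw [pow_succ']
    refine step ht hc.left hj' _ _ ?_
    rcases Multiset.mem_add.1 hj' with h | h
    · rw [fixed nr (h1 (leaf_mem hc)) (h1 h)]
      exact ih nl h y₀
    -- The subtree of j' must be sampled first, so that y j' is fixed when l is sampled.
    · rw [expect_comm _ _ hd]
      refine expect_le_const hP nr fun y _ _ => ?_
      have := frozen nl ((SubtreeAt.left .refl).trans hc) (fun h' => h1 h' h) 1 y
      rwa [show 0 + 1 + c = c + 1 by omega] at this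
  | @right c l r hc ih =>
    obtain ⟨nl, nr, hd⟩ := Multiset.nodup_add.1 ht
    have h1 : ∀ {a}, a ∈ leaves l → a ∉ leaves r := fun h => Multiset.disjoint_left.1 hd h
    rw [pow_succ']
    refine step ht hc.right hj' _ _ ?_
    rcases Multiset.mem_add.1 hj' with h | h
    · refine expect_le_const hP nl fun y _ _ => ?_
      have := frozen nr ((SubtreeAt.left .refl).trans hc) (h1 h) 1 y
      rwa [show 0 + 1 + c = c + 1 by omega] at this
    · exact expect_le_const hP nl fun y _ _ => ih nr h y

end Expectation


/-! ### The bound for the coefficient of a reduced fraction -/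

section Bound

/-- The probabilities `α²` and `β²` of the two states. -/
def stateProb (α : ℝ) (s : Bool) : ℝ≥0∞ := ENNReal.ofReal (stateWeight α s ^ 2)

theorem stateProb_add (α : unitInterval) : stateProb α false + stateProb α true = 1 :=
  stateWeight_sq α

-- By injectivity of the branching map, at most one state at x produces the pair u, and x must then
-- be the parent of u.
open Classical in
theorem sum_stateProb_branch (α : ℝ) (x : Word) (u : Word × Word) :
    stateProb α false * (if u = branch false x then 1 else 0) +
      stateProb α true * (if u = branch true x then 1 else 0) =
    if parent u = x then ENNReal.ofReal (parentWeight α u ^ 2) else 0 := by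
  by_cases h : ∃ s x', branch s x' = u
  · obtain ⟨s, x', rfl⟩ := h
    have hb : ∀ s', branch s x' = branch s' x ↔ s = s' ∧ x' = x := fun s' =>
      ⟨fun h => Prod.ext_iff.1 (@branch_injective (s, x') (s', x) h), fun h => by rw [h.1, h.2]⟩
    simp only [hb, parent_branch, parentWeight_branch]
    by_cases hx : x' = x <;> cases s <;> simp [hx, stateProb]
  · push Not at h
    rw [parentWeight_eq_zero α h, if_neg (h _ _).symm, if_neg (h _ _).symm]
    simp

-- The probability of obtaining prescribed words is the squared weight of the tree. The set D is
-- arbitrary because, after averaging over the right subtree, the left one faces the same question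
-- with the labels of the right one removed.
open Classical in
theorem expect_agree {J : Type} [DecidableEq J] (α : ℝ) (y : J → Word) (t : BinTree J)
    (ht : (leaves t).Nodup) (D : Set J) (hD : ∀ j ∈ leaves t, j ∈ D) (x : Word) (y₀ : J → Word) :
    expect (stateProb α) t x (fun y' => if ∀ j ∈ D, y' j = y j then 1 else 0) y₀ =
      (if rootWord y t = x then ENNReal.ofReal (rootWeight α y t ^ 2) else 0) *
        (if ∀ j ∈ D, j ∉ leaves t → y₀ j = y j then 1 else 0) := by
  induction t generalizing D x y₀ with
  | leaf j =>
    have h : (∀ k ∈ D, Function.update y₀ j x k = y k) ↔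
        (y j = x) ∧ ∀ k ∈ D, k ∉ leaves (.leaf j) → y₀ k = y k := by
      constructor
      · intro h
        refine ⟨by simpa using (h j (hD j (by simp [leaves]))).symm, fun k hk hkj => ?_⟩
        rw [← h k hk, Function.update_of_ne (by simpa [leaves] using hkj)]
      · rintro ⟨h1, h2⟩ k hk
        by_cases hkj : k = j
        · subst hkj; simp [h1]
        · rw [Function.update_of_ne hkj, h2 k hk (by simpa [leaves] using hkj)]
    simp only [expect, h, rootWord, rootWeight, one_pow, ENNReal.ofReal_one]
    split_ifs <;> simp_all
  | node l r hl hr =>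
    obtain ⟨nl, nr, hd⟩ := Multiset.nodup_add.1 ht
    have hDl : ∀ j ∈ leaves l, j ∈ D := fun j hj => hD j (Multiset.mem_add.2 (Or.inl hj))
    have hDr : ∀ j ∈ leaves r, j ∈ D := fun j hj => hD j (Multiset.mem_add.2 (Or.inr hj))
    have e1 : ∀ s, expect (stateProb α) r (branch s x).2
        (fun y' => if ∀ j ∈ D, y' j = y j then 1 else 0) = fun y' =>
        (if rootWord y r = (branch s x).2 then ENNReal.ofReal (rootWeight α y r ^ 2) else 0) *
          (if ∀ j ∈ D \ {j | j ∈ leaves r}, y' j = y j then 1 else 0) := fun s => funext fun y' => by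
      rw [hr nr D hDr]
      simp only [Set.mem_sdiff, Set.mem_ofPred_eq, and_imp]
    have e2 : ∀ s, expect (stateProb α) l (branch s x).1
        (fun y' => if ∀ j ∈ D \ {j | j ∈ leaves r}, y' j = y j then 1 else 0) y₀ =
        (if rootWord y l = (branch s x).1 then ENNReal.ofReal (rootWeight α y l ^ 2) else 0) *
          (if ∀ j ∈ D, j ∉ leaves (.node l r) → y₀ j = y j then 1 else 0) := fun s => by
      rw [hl nl (D \ {j | j ∈ leaves r}) fun j hj => ⟨hDl j hj, Multiset.disjoint_left.1 hd hj⟩]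
      simp only [Set.mem_sdiff, Set.mem_ofPred_eq, and_imp, leaves, Multiset.mem_add, not_or]
      congr 2
      exact propext ⟨fun h j h1 h2 h3 => h j h1 h3 h2, fun h j h1 h2 h3 => h j h1 h3 h2⟩
    have e3 : ∀ s, ((rootWord y l, rootWord y r) = branch s x) ↔
        rootWord y r = (branch s x).2 ∧ rootWord y l = (branch s x).1 := fun s => by
      rw [Prod.ext_iff, and_comm]
    have key := sum_stateProb_branch α x (rootWord y l, rootWord y r)
    simp only [e3, ite_and] at key
    simp only [expect, e1, expect_const_mul, e2, rootWord, rootWeight, mul_pow,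
      ENNReal.ofReal_mul (sq_nonneg _)]
    rw [← ite_zero_mul, ← key]
    split_ifs <;> simp <;> ring

-- Links probability with operators: for x = e the weights on the right are the squared coefficients
-- of Φ_α(t)δ_e.
open Classical in
theorem expect_eq_tsum {J : Type} [DecidableEq J] (α : ℝ) {t : BinTree J} (ht : (leaves t).Nodup)
    (hJ : ∀ j, j ∈ leaves t) (x : Word) (g : (J → Word) → ℝ≥0∞) (y₀ : J → Word) :
    expect (stateProb α) t x g y₀ = ∑' y, g y *
      (if rootWord y t = x then ENNReal.ofReal (rootWeight α y t ^ 2) else 0) := by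
  have hg : g = fun y' => ∑' y, g y * (if ∀ j ∈ Set.univ, y' j = y j then 1 else 0) := by
    funext y'
    rw [tsum_eq_single y' fun y hy => by
      rw [if_neg fun h => hy (funext fun j => (h j trivial).symm), mul_zero]]
    simp
  conv_lhs => rw [hg]
  rw [expect_tsum]
  refine tsum_congr fun y => ?_
  rw [expect_const_mul]
  dsimp only
  rw [expect_agree α y t ht Set.univ fun _ _ => trivial]
  simp [hJ]

-- Cauchy–Schwarz after cutting ξ down to S, which does not change the inner product.
open Classical in
theorem norm_inner_sq_le_tsum {A : Type} (ξ η : lp (fun _ : A => ℂ) 2) (S : Set A)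
    (h : ∀ y ∉ S, ξ y = 0 ∨ η y = 0) : ENNReal.ofReal (‖inner ℂ ξ η‖ ^ 2) ≤
      (∑' y, if y ∈ S then ENNReal.ofReal (‖ξ y‖ ^ 2) else 0) * ENNReal.ofReal (‖η‖ ^ 2) := by
  have hle : ∀ y, (if y ∈ S then ENNReal.ofReal (‖ξ y‖ ^ 2) else 0) ≤
      ENNReal.ofReal (‖ξ y‖ ^ 2) := fun y => by split_ifs <;> simp
  have hn : ∀ y, ENNReal.ofReal (‖if y ∈ S then ξ y else 0‖ ^ 2) =
      if y ∈ S then ENNReal.ofReal (‖ξ y‖ ^ 2) else 0 := fun y => by split_ifs <;> simp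
  have hfin : ∑' y, (if y ∈ S then ENNReal.ofReal (‖ξ y‖ ^ 2) else 0) ≠ ∞ :=
    ne_top_of_le_ne_top ((memlp_two_iff _).1 ξ.2) (ENNReal.tsum_le_tsum hle)
  let ζ : lp (fun _ : A => ℂ) 2 := ⟨fun y => if y ∈ S then ξ y else 0,
    (memlp_two_iff _).2 (by simp only [hn]; exact hfin)⟩
  have hζ : ‖ζ‖ ^ 2 = (∑' y, if y ∈ S then ENNReal.ofReal (‖ξ y‖ ^ 2) else 0).toReal := by
    rw [norm_sq_eq]
    exact congrArg ENNReal.toReal (tsum_congr hn)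
  have hi : inner ℂ ξ η = inner ℂ ζ η := by
    rw [lp.inner_eq_tsum, lp.inner_eq_tsum]
    refine tsum_congr fun y => ?_
    change _ = inner ℂ (if y ∈ S then ξ y else 0) (η y)
    split_ifs with hy
    · rfl
    · rcases h y hy with h | h <;> simp [h]
  rw [← ENNReal.ofReal_toReal hfin, ← hζ, ← ENNReal.ofReal_mul (sq_nonneg _), hi, ← mul_pow]
  exact ENNReal.ofReal_le_ofReal (pow_le_pow_left₀ (norm_nonneg _) (norm_inner_le_norm _ _) 2)

/-- The tree of a morphism with source `1`. -/
def singleTree {Y : SymForest} (t : (⟨1⟩ : SymForest) ⟶ Y) : BinTree (Fin Y.width) :=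
  t.tree (0 : Fin 1)

theorem leaves_singleTree {Y : SymForest} (t : (⟨1⟩ : SymForest) ⟶ Y) :
    leaves (singleTree t) = Finset.univ.val := by
  have h : ∑ i : Fin 1, leaves (t.tree i) = Finset.univ.val := t.isLabelling
  rwa [Fin.sum_univ_one] at h

theorem singleTree_injective {Y : SymForest} :
    Function.Injective (singleTree : ((⟨1⟩ : SymForest) ⟶ Y) → _) := fun t s h =>
  SymForest.Hom.ext (funext fun (i : Fin 1) => by
    rw [Subsingleton.elim i 0]
    exact h)

theorem nodup_leaves_singleTree {Y : SymForest} (t : (⟨1⟩ : SymForest) ⟶ Y) :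
    (leaves (singleTree t)).Nodup := by
  rw [leaves_singleTree]; exact Finset.univ.nodup

theorem mem_leaves_singleTree {Y : SymForest} (t : (⟨1⟩ : SymForest) ⟶ Y) (j : Fin Y.width) :
    j ∈ leaves (singleTree t) := by
  rw [leaves_singleTree]; exact Finset.mem_univ j

theorem card_leaves_singleTree {Y : SymForest} (t : (⟨1⟩ : SymForest) ⟶ Y) :
    Multiset.card (leaves (singleTree t)) = Y.width := by
  rw [leaves_singleTree]; exact Finset.card_fin _

open Classical in
theorem forestIsometry_dirac_one (α : unitInterval) {Y : SymForest} (t : (⟨1⟩ : SymForest) ⟶ Y)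
    (y : Fin Y.width → Word) :
    forestIsometry α t (dirac fun _ => 1) y = ((if rootWord y (singleTree t) = 1 then
      rootWeight α y (singleTree t) else 0 : ℝ) : ℂ) := by
  have hw : forestWeight α t y = rootWeight α y (singleTree t) := by
    change ∏ i : Fin 1, rootWeight α y (t.tree i) = _
    rw [Fin.prod_univ_one]; rfl
  have hx : (forestWord t y = fun _ => 1) ↔ rootWord y (singleTree t) = 1 :=
    ⟨fun h => congrFun h (0 : Fin 1), fun h => funext fun (i : Fin 1) => by
      rw [Subsingleton.elim i 0]
      exact h⟩
  rw [forestIsometry_apply, dirac_apply, if_congr hx rfl rfl, hw]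
  split_ifs <;> simp

theorem norm_dirac {X : SymForest} (w : Fin X.width → Word) : ‖dirac w‖ = 1 := by
  classical
  rw [dirac, lp.norm_single (by norm_num), norm_one]

theorem phi_mk (α : unitInterval) {Y : SymForest} (t s : (⟨1⟩ : SymForest) ⟶ Y) :
    phi α (.mk t s) = inner ℂ (forestIsometry α t (dirac fun _ => 1))
      (forestIsometry α s (dirac fun _ => 1)) :=
  (wordFunctor α).coefficient_mk _ t s

open Classical in
theorem norm_phi_sq_le_expect (α : unitInterval) {Y : SymForest} (t s : (⟨1⟩ : SymForest) ⟶ Y) :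
    ENNReal.ofReal (‖phi α (.mk t s)‖ ^ 2) ≤ expect (stateProb α) (singleTree t) 1
      (fun y => if Admissible (singleTree s) 1 y then 1 else 0) 1 := by
  rw [phi_mk, expect_eq_tsum _ (nodup_leaves_singleTree t) (mem_leaves_singleTree t)]
  refine (norm_inner_sq_le_tsum _ _ {y | Admissible (singleTree s) 1 y} fun y hy => Or.inr ?_).trans
    (le_of_eq ?_)
  · rw [forestIsometry_dirac_one]
    split_ifs with h
    · by_cases h0 : rootWeight α y (singleTree s) = 0
      · rw [h0, Complex.ofReal_zero]
      · exact absurd (h ▸ admissible_of_rootWeight_ne_zero h0) hy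
    · simp
  · rw [(forestIsometry α s).norm_map, norm_dirac, one_pow, ENNReal.ofReal_one, mul_one]
    refine tsum_congr fun y => ?_
    rw [forestIsometry_dirac_one, Complex.norm_real, Real.norm_eq_abs, sq_abs, Set.mem_ofPred_eq]
    split_ifs <;> simp

/-- The trees of `t` and `s` have no caret in common. -/
def NoCommonCaret {J : Type} (t s : BinTree J) : Prop :=
  ∀ i j k m, SubtreeAt (.node (.leaf i) (.leaf j)) k t →
    ¬ SubtreeAt (.node (.leaf i) (.leaf j)) m s

/-- Looks up, in s, the sibling u of the leaf i of a deepest caret (i, j) of t. Either u has a leaf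
other than j, and the relation this imposes is improbable in t, or u is the leaf j and s contains
the caret in reversed order. -/
theorem norm_phi_sq_le (α : unitInterval) {Y : SymForest} (t s : (⟨1⟩ : SymForest) ⟶ Y)
    (h : NoCommonCaret (singleTree t) (singleTree s)) {γ : ℝ≥0∞} (hγ : ∀ b, stateProb α b ≤ γ) :
    ENNReal.ofReal (‖phi α (.mk t s)‖ ^ 2) ≤ γ ^ depth (singleTree t) := by
  classical
  have hP := stateProb_add α
  have nt := nodup_leaves_singleTree t
  have ns := nodup_leaves_singleTree s
  refine (norm_phi_sq_le_expect α t s).trans ?_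
  by_cases h0 : depth (singleTree t) = 0
  · rw [h0, pow_zero]
    exact expect_le_const hP nt fun y _ _ => by split_ifs <;> simp
  obtain ⟨i, j, hc⟩ := exists_deepest_caret _ h0
  -- Both trees have the same number of leaves, and t has at least two.
  have hs : depth (singleTree s) ≠ 0 := fun hs => by
    have h1 := card_leaves_le (singleTree s)
    have h2 := depth_lt_card_leaves (singleTree t)
    rw [card_leaves_singleTree, hs, pow_zero] at h1
    rw [card_leaves_singleTree] at h2
    omega
  rw [← Nat.sub_add_cancel (Nat.one_le_iff_ne_zero.2 h0)]
  obtain ⟨u, hu⟩ := exists_sibling (mem_leaves_singleTree s i) hs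
  by_cases huj : ∃ j' ∈ leaves u, j' ≠ j
  · obtain ⟨j', hj', hne⟩ := huj
    have hi : j' ≠ i := by
      rintro rfl
      exact Multiset.disjoint_left.1 (hu.disjoint ns).2 (Multiset.mem_singleton_self _) hj'
    obtain ⟨k, hk⟩ := exists_subtreeAt_leaf hj'
    refine le_trans (expect_mono nt fun y _ _ => ?_) (expect_repetition_le (k := k) hP hγ nt hc
      (mem_leaves_singleTree t j') hi hne _)
    by_cases ha : Admissible (singleTree s) 1 y
    · rw [if_pos ha, if_pos (ha.sibling_word hu hk)]
    · rw [if_neg ha]; exact zero_le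
  · push Not at huj
    obtain rfl := eq_leaf_of_forall_mem_leaves (hu.disjoint ns).1 huj
    obtain ⟨m, hu⟩ := hu
    -- A caret of s in the same order would be common to both trees.
    have hu' := hu.resolve_left (h i j _ m hc)
    have hi := (SubtreeAt.left .refl).trans hc
    rw [zero_add, add_comm 1] at hi
    refine le_trans (expect_mono nt fun y hy _ => ?_) (expect_word_eq_le hP hγ nt hi _ 1 _)
    by_cases ha : Admissible (singleTree s) 1 y
    · rw [if_pos ha, if_pos (hy.eq_one_of_swapped_carets hc hu' ha)]
    · rw [if_neg ha]; exact zero_le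

end Bound


/-! ### Positive definiteness -/

/-- By unitarity the matrix is the Gram matrix of the vectors π(g i)x, so the double sum is the
squared norm of ∑ c i • π(g i)x. -/
theorem HilbFunctor.isPositiveDefinite_coefficient {C : Type} [Category.{0} C] [LeftCalculus C]
    (Φ : HilbFunctor C) (e : C) (x : Φ.space e) : IsPositiveDefinite (Φ.coefficient e x) := by
  intro n g c
  set z := Φ.base e x with hz
  have h : ∀ i j, Φ.coefficient e x ((g i)⁻¹ * g j) =
      inner ℂ (Φ.jonesRep e (g i) z) (Φ.jonesRep e (g j) z) := fun i j => by
    have h1 : Φ.jonesRep e (g i) (Φ.jonesRep e ((g i)⁻¹ * g j) z) = Φ.jonesRep e (g j) z := by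
      conv_rhs => rw [← mul_inv_cancel_left (g i) (g j), map_mul]
      rfl
    rw [← h1, LinearIsometryEquiv.inner_map_map, coefficient]
  have hs : ∑ i, ∑ j, conj (c i) * c j * Φ.coefficient e x ((g i)⁻¹ * g j) =
      inner ℂ (∑ i, c i • Φ.jonesRep e (g i) z) (∑ i, c i • Φ.jonesRep e (g i) z) := by
    rw [sum_inner]
    refine Finset.sum_congr rfl fun i _ => ?_
    rw [inner_sum]
    refine Finset.sum_congr rfl fun j _ => ?_
    rw [h, inner_smul_left, inner_smul_right, mul_assoc]
  rw [hs, inner_self_eq_norm_sq_to_K, ← RCLike.ofReal_pow]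
  exact Complex.zero_le_real.2 (sq_nonneg _)

/-! ### Reduced fractions -/

section Reduction

variable {J K : Type} [DecidableEq J] {i j : J} {f : K → J}

/-- The trees that put a caret with leaves `i`, `j` at the label `i`. -/
def caretAt (i j : J) (f : K → J) (k : K) : BinTree J :=
  if f k = i then .node (.leaf i) (.leaf j) else .leaf (f k)

theorem exists_graft_caretAt_of_notMem (hf : ∀ k, k ≠ j → ∃ k', f k' = k) {t : BinTree J}
    (hi : i ∉ leaves t) (hj : j ∉ leaves t) : ∃ t', graft (caretAt i j f) t' = t := by
  induction t with
  | leaf k =>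
    simp only [leaves, Multiset.mem_singleton] at hi hj
    obtain ⟨k', rfl⟩ := hf k (Ne.symm hj)
    exact ⟨.leaf k', if_neg (Ne.symm hi)⟩
  | node l r hl hr =>
    simp only [leaves, Multiset.mem_add, not_or] at hi hj
    obtain ⟨l', rfl⟩ := hl hi.1 hj.1
    obtain ⟨r', rfl⟩ := hr hi.2 hj.2
    exact ⟨.node l' r', rfl⟩

theorem exists_graft_caretAt (hf : ∀ k, k ≠ j → ∃ k', f k' = k) {t : BinTree J}
    (ht : (leaves t).Nodup) {m : ℕ} (h : SubtreeAt (.node (.leaf i) (.leaf j)) m t) :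
    ∃ t', graft (caretAt i j f) t' = t := by
  have leaf_mem : ∀ {t : BinTree J} {m : ℕ} (_ : SubtreeAt (.node (.leaf i) (.leaf j)) m t),
      i ∈ leaves t ∧ j ∈ leaves t := fun h =>
    ⟨Multiset.mem_of_le h.leaves_le (by simp [leaves]),
      Multiset.mem_of_le h.leaves_le (by simp [leaves])⟩
  induction h with
  | refl =>
    have hij : i ≠ j := by simpa [leaves, eq_comm] using ht
    obtain ⟨k, hk⟩ := hf i hij
    exact ⟨.leaf k, if_pos hk⟩
  | left h ih =>
    obtain ⟨nl, nr, hd⟩ := Multiset.nodup_add.1 ht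
    obtain ⟨l', rfl⟩ := ih nl
    obtain ⟨r', rfl⟩ := exists_graft_caretAt_of_notMem hf
      (Multiset.disjoint_left.1 hd (leaf_mem h).1) (Multiset.disjoint_left.1 hd (leaf_mem h).2)
    exact ⟨.node l' r', rfl⟩
  | right h ih =>
    obtain ⟨nl, nr, hd⟩ := Multiset.nodup_add.1 ht
    obtain ⟨r', rfl⟩ := ih nr
    obtain ⟨l', rfl⟩ := exists_graft_caretAt_of_notMem hf
      (Multiset.disjoint_right.1 hd (leaf_mem h).1) (Multiset.disjoint_right.1 hd (leaf_mem h).2)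
    exact ⟨.node l' r', rfl⟩

/-- Grafting only renames leaves by f and adds leaves labelled j, which is outside the range of f.
-/
theorem count_leaves_graft_caretAt [DecidableEq K] (hf : Function.Injective f)
    (hj : ∀ k, f k ≠ j) (t : BinTree K) (k : K) :
    Multiset.count (f k) (leaves (graft (caretAt i j f) t)) = Multiset.count k (leaves t) := by
  induction t with
  | leaf k' =>
    simp only [graft, caretAt]
    split_ifs with h
    · simp only [leaves, Multiset.count_add, Multiset.count_singleton, hj, if_false, add_zero, ← h,
        hf.eq_iff]
    · simp only [leaves, Multiset.count_singleton, hf.eq_iff]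
  | node l r hl hr => simp only [graft, leaves, Multiset.count_add, hl, hr]

theorem leaves_eq_univ_of_graft_caretAt [Fintype J] [Fintype K] (hf : Function.Injective f)
    (hj : ∀ k, f k ≠ j) {t : BinTree K}
    (h : leaves (graft (caretAt i j f) t) = Finset.univ.val) : leaves t = Finset.univ.val := by
  classical
  ext k
  rw [← count_leaves_graft_caretAt (i := i) hf hj t k, h,
    Multiset.count_eq_one_of_mem Finset.univ.nodup (Finset.mem_univ _),
    Multiset.count_eq_one_of_mem Finset.univ.nodup (Finset.mem_univ _)]

/-- The morphism with source `1` given by a tree. -/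
def ofTree {Y : SymForest} (t : BinTree (Fin Y.width)) (h : leaves t = Finset.univ.val) :
    (⟨1⟩ : SymForest) ⟶ Y where
  tree _ := t
  isLabelling := by
    change ∑ _i : Fin 1, leaves t = _
    rw [Fin.sum_univ_one, h]

/-- A common caret (i, j) is a common right factor: the forest p puts that caret on the leaf i, and
both trees factor through it. -/
theorem exists_smaller_fraction {Y : SymForest} (t s : (⟨1⟩ : SymForest) ⟶ Y)
    (h : ¬ NoCommonCaret (singleTree t) (singleTree s)) :
    ∃ (Y' : SymForest) (t' s' : (⟨1⟩ : SymForest) ⟶ Y'),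
      FractionGroup.mk t' s' = FractionGroup.mk t s ∧ Y'.width < Y.width := by
  simp only [NoCommonCaret, not_forall, not_not] at h
  obtain ⟨i, j, k, m, ht, hs⟩ := h
  have nt := nodup_leaves_singleTree t
  have ns := nodup_leaves_singleTree s
  have hij : i ≠ j := by
    simpa [leaves, eq_comm] using Multiset.nodup_of_le ht.leaves_le nt
  have h2 : 1 < (Y.width : ℕ) := by
    have := Fintype.one_lt_card_iff.2 ⟨i, j, hij⟩
    rwa [Fintype.card_fin] at this
  -- The leaves after pruning are the old labels except j, renumbered by f; the label i stands for
  -- the removed caret.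
  let Y' : SymForest := ⟨⟨Y.width - 1, by omega⟩⟩
  have hcard : Fintype.card (Fin Y'.width) = Fintype.card {k : Fin Y.width // k ≠ j} := by
    rw [Fintype.card_fin, Fintype.card_subtype_compl, Fintype.card_fin, Fintype.card_subtype_eq]
    rfl
  let e := Fintype.equivOfCardEq hcard
  let f : Fin Y'.width → Fin Y.width := fun k => (e k : Fin Y.width)
  have hf : Function.Injective f := Subtype.val_injective.comp e.injective
  have hfj : ∀ k, f k ≠ j := fun k => (e k).2
  have hf' : ∀ k, k ≠ j → ∃ k', f k' = k := fun k hk => ⟨e.symm ⟨k, hk⟩, by simp [f]⟩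
  obtain ⟨t', ht'⟩ := exists_graft_caretAt (f := f) hf' nt ht
  obtain ⟨s', hs'⟩ := exists_graft_caretAt (f := f) hf' ns hs
  have lt : leaves t' = Finset.univ.val := leaves_eq_univ_of_graft_caretAt hf hfj
    (by rw [ht', leaves_singleTree])
  have ls : leaves s' = Finset.univ.val := leaves_eq_univ_of_graft_caretAt hf hfj
    (by rw [hs', leaves_singleTree])
  let p : Y' ⟶ Y := ⟨caretAt i j f, (IsLabelling.comp (ofTree t' lt).isLabelling).1 (by
    change ∑ _i : Fin 1, leaves (graft _ t') = _
    rw [Fin.sum_univ_one, ht', leaves_singleTree])⟩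
  have hpt : ofTree t' lt ≫ p = t := singleTree_injective ht'
  have hps : ofTree s' ls ≫ p = s := singleTree_injective hs'
  refine ⟨Y', ofTree t' lt, ofTree s' ls, ?_, ?_⟩
  · rw [← FractionGroup.mk_comp _ _ p, hpt, hps]
  · rw [← PNat.coe_lt_coe]
    change (Y.width : ℕ) - 1 < Y.width
    omega

theorem exists_reduced_fraction (v : ThompsonV) :
    ∃ (Y : SymForest) (t s : (⟨1⟩ : SymForest) ⟶ Y),
      FractionGroup.mk t s = v ∧ NoCommonCaret (singleTree t) (singleTree s) := by
  have key : ∀ (n : ℕ) (Y : SymForest) (t s : (⟨1⟩ : SymForest) ⟶ Y), (Y.width : ℕ) = n →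
      ∃ (Y' : SymForest) (t' s' : (⟨1⟩ : SymForest) ⟶ Y'),
        FractionGroup.mk t' s' = FractionGroup.mk t s ∧
          NoCommonCaret (singleTree t') (singleTree s') := by
    intro n
    induction n using Nat.strong_induction_on with
    | _ n ih =>
      intro Y t s hn
      by_cases h : NoCommonCaret (singleTree t) (singleTree s)
      · exact ⟨Y, t, s, rfl, h⟩
      · obtain ⟨Y', t', s', h1, h2⟩ := exists_smaller_fraction t s h
        obtain ⟨Y'', t'', s'', h3, h4⟩ := ih Y'.width (hn ▸ h2) Y' t' s' rfl
        exact ⟨Y'', t'', s'', h3.trans h1, h4⟩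
  induction v using FractionGroup.ind with | h Y t s => exact key _ Y t s rfl

end Reduction

/-! ### Finiteness and vanishing at infinity -/

theorem finite_hom (Y : SymForest) : Finite ((⟨1⟩ : SymForest) ⟶ Y) := by
  have := (finite_setOf_depth_le (J := Fin Y.width) Y.width).to_subtype
  refine Finite.of_injective (β := {t : BinTree (Fin Y.width) | depth t ≤ Y.width})
    (fun t => ⟨singleTree t, ?_⟩) fun t s h => singleTree_injective (congrArg Subtype.val h)
  have h := depth_lt_card_leaves (singleTree t)
  rw [card_leaves_singleTree] at h
  exact h.le

theorem finite_setOf_width_le (N : ℕ) : {v : ThompsonV | ∃ (Y : SymForest)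
    (t s : (⟨1⟩ : SymForest) ⟶ Y), FractionGroup.mk t s = v ∧ (Y.width : ℕ) ≤ N}.Finite := by
  have := finite_hom
  refine (Set.finite_range fun p : Σ n : Fin N, ((⟨1⟩ : SymForest) ⟶ ⟨n.1.succPNat⟩) ×
    ((⟨1⟩ : SymForest) ⟶ ⟨n.1.succPNat⟩) => FractionGroup.mk p.2.1 p.2.2).subset ?_
  rintro _ ⟨⟨w⟩, t, s, rfl, h⟩
  obtain ⟨n, rfl⟩ : ∃ n : ℕ, w = n.succPNat := ⟨w.natPred, (PNat.succPNat_natPred w).symm⟩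
  exact ⟨⟨⟨n, h⟩, t, s⟩, rfl⟩

/-- A reduced fraction with more than 2^D leaves has depth at least D, so its coefficient is small
once γ^D < ε²; all remaining elements have at most 2^D leaves. -/
theorem vanishesAtInfinity_phi (α : unitInterval) (h0 : 0 < α) (h1 : α < 1) :
    VanishesAtInfinity (phi α) := by
  have h0' : (0 : ℝ) < α := h0
  have h1' : (α : ℝ) < 1 := h1
  obtain ⟨γ, hγ, hγ1⟩ : ∃ γ : ℝ≥0∞, (∀ b, stateProb α b ≤ γ) ∧ γ < 1 := by
    refine ⟨max (stateProb α false) (stateProb α true), fun b => ?_, max_lt ?_ ?_⟩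
    · cases b
      · exact le_max_left _ _
      · exact le_max_right _ _
    · rw [stateProb, ENNReal.ofReal_lt_one, stateWeight, if_neg (by simp)]
      nlinarith
    -- Here β² = 1 - α² < 1 uses α > 0; the previous case uses α < 1.
    · rw [stateProb, ENNReal.ofReal_lt_one, stateWeight, if_pos rfl, Real.sq_sqrt (by nlinarith)]
      nlinarith
  rw [VanishesAtInfinity, NormedAddGroup.tendsto_nhds_zero]
  intro ε hε
  obtain ⟨D, hD⟩ : ∃ D : ℕ, γ ^ D < ENNReal.ofReal (ε ^ 2) :=
    ((ENNReal.tendsto_pow_atTop_nhds_zero_of_lt_one hγ1).eventually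
      (gt_mem_nhds (ENNReal.ofReal_pos.2 (by positivity)))).exists
  refine (finite_setOf_width_le (2 ^ D)).subset fun v hv => ?_
  obtain ⟨Y, t, s, rfl, hr⟩ := exists_reduced_fraction v
  refine ⟨Y, t, s, rfl, ?_⟩
  by_contra! hw
  have hd : D ≤ depth (singleTree t) := by
    have := card_leaves_le (singleTree t)
    rw [card_leaves_singleTree] at this
    exact ((Nat.pow_lt_pow_iff_right one_lt_two).1 (hw.trans_le this)).le
  refine hv ?_
  have h := ((norm_phi_sq_le α t s hr hγ).trans (pow_le_pow_right_of_le_one' hγ1.le hd)).trans_lt hD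
  exact lt_of_pow_lt_pow_left₀ 2 hε.le ((ENNReal.ofReal_lt_ofReal_iff (by positivity)).1 h)

/-! ### The limit α → 1 and the Haagerup property -/

theorem parentWeight_nonneg (α : unitInterval) (u : Word × Word) : 0 ≤ parentWeight α u := by
  by_cases h : ∃ s x, branch s x = u
  · obtain ⟨s, x, rfl⟩ := h
    rw [parentWeight_branch, stateWeight]
    split_ifs
    · exact Real.sqrt_nonneg _
    · exact α.2.1
  · push Not at h
    rw [parentWeight_eq_zero _ h]

theorem rootWeight_nonneg (α : unitInterval) {J : Type} (y : J → Word) (t : BinTree J) :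
    0 ≤ rootWeight α y t := by
  induction t with
  | leaf j => exact zero_le_one
  | node l r hl hr => exact mul_nonneg (parentWeight_nonneg α _) (mul_nonneg hl hr)

theorem rootWord_one {J : Type} (t : BinTree J) : rootWord (1 : J → Word) t = 1 := by
  induction t with
  | leaf j => rfl
  | node l r hl hr => rw [rootWord, hl, hr, ← branch_false_one, parent_branch]

theorem rootWeight_one (α : ℝ) {J : Type} (t : BinTree J) :
    rootWeight α (1 : J → Word) t = α ^ nodes t := by
  induction t with
  | leaf j => rfl
  | node l r hl hr =>
    rw [rootWeight, rootWord_one, rootWord_one, hl, hr, ← branch_false_one, parentWeight_branch,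
      stateWeight, if_neg (by simp), nodes]
    ring

/-- The inner product is a sum of nonnegative reals, so it dominates its term at the all-empty
labelling, where each vertex of either tree contributes a factor α. The upper bound is
Cauchy–Schwarz for unit vectors. -/
theorem exists_phi_eq_ofReal (α : unitInterval) {Y : SymForest} (t s : (⟨1⟩ : SymForest) ⟶ Y) :
    ∃ r : ℝ, phi α (.mk t s) = r ∧
      (α : ℝ) ^ (nodes (singleTree t) + nodes (singleTree s)) ≤ r ∧ r ≤ 1 := by
  classical
  set w : ((⟨1⟩ : SymForest) ⟶ Y) → (Fin Y.width → Word) → ℝ := fun t y =>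
    if rootWord y (singleTree t) = 1 then rootWeight α y (singleTree t) else 0 with hw
  have hw0 : ∀ t y, 0 ≤ w t y := fun t y => by
    simp only [hw]
    split_ifs
    · exact rootWeight_nonneg α y _
    · exact le_rfl
  have hs : HasSum (fun y => ((w t y * w s y : ℝ) : ℂ)) (phi α (.mk t s)) := by
    rw [phi_mk]
    have h : (fun y => ((w t y * w s y : ℝ) : ℂ)) = fun y =>
        inner ℂ (forestIsometry α t (dirac fun _ => 1) y)
          (forestIsometry α s (dirac fun _ => 1) y) := funext fun y => by
      rw [forestIsometry_dirac_one, forestIsometry_dirac_one, RCLike.inner_apply,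
        Complex.conj_ofReal, ← Complex.ofReal_mul, mul_comm]
    rw [h]
    exact lp.hasSum_inner _ _
  have him : (phi α (.mk t s)).im = 0 := by
    have := Complex.hasSum_im hs
    simp only [Complex.ofReal_im] at this
    exact this.unique hasSum_zero
  have hre : HasSum (fun y => w t y * w s y) (phi α (.mk t s)).re := by
    simpa using Complex.hasSum_re hs
  refine ⟨(phi α (.mk t s)).re, Complex.ext rfl him, ?_, ?_⟩
  · have h := le_hasSum hre 1 fun y _ => mul_nonneg (hw0 t y) (hw0 s y)
    simpa only [hw, rootWord_one, rootWeight_one, if_true, ← pow_add] using h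
  · refine (Complex.re_le_norm _).trans ?_
    rw [phi_mk]
    refine (norm_inner_le_norm _ _).trans ?_
    rw [LinearIsometry.norm_map, LinearIsometry.norm_map, norm_dirac, one_mul]

theorem tendsto_phi (v : ThompsonV) :
    Tendsto (fun α : unitInterval => phi α v) (𝓝[<] 1) (𝓝 1) := by
  induction v using FractionGroup.ind with | h Y t s =>
  choose r hr hl hu using fun α : unitInterval => exists_phi_eq_ofReal α t s
  simp only [hr]
  have hc : Tendsto (fun α : unitInterval =>
      (α : ℝ) ^ (nodes (singleTree t) + nodes (singleTree s))) (𝓝[<] 1) (𝓝 1) := by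
    have : Continuous fun α : unitInterval =>
      (α : ℝ) ^ (nodes (singleTree t) + nodes (singleTree s)) := by fun_prop
    simpa using (this.tendsto 1).mono_left nhdsWithin_le_nhds
  exact_mod_cast (Complex.continuous_ofReal.tendsto 1).comp
    (tendsto_of_tendsto_of_tendsto_of_le_of_le hc tendsto_const_nhds hl hu)

theorem haagerupProperty_thompsonV : HaagerupProperty ThompsonV := by
  have h01 : (0 : unitInterval) < 1 := zero_lt_one
  refine ⟨Set.Ioo (0 : unitInterval) 1, inferInstance, inferInstance,
    (Set.nonempty_Ioo.2 h01).to_subtype, fun α => phi α,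
    fun α => HilbFunctor.isPositiveDefinite_coefficient _ _ _,
    fun α => vanishesAtInfinity_phi α α.2.1 α.2.2, fun v => ?_⟩
  -- The net is indexed by the open interval with its usual order, for which `atTop` corresponds to
  -- the left neighbourhoods of 1.
  exact (tendsto_comp_coe_Ioo_atTop h01).2 (tendsto_phi v)

end Jones
end

theorem mainTheorem6 :
    (∀ α : unitInterval, 0 < α → α < 1 →
      Jones.IsPositiveDefinite (Jones.phi α) ∧ Jones.VanishesAtInfinity (Jones.phi α)) ∧
    (∀ v : Jones.ThompsonV, Tendsto (fun α : unitInterval => Jones.phi α v) (𝓝[<] 1) (𝓝 1)) ∧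
    Jones.HaagerupProperty Jones.ThompsonV :=
  ⟨fun α h0 h1 => ⟨Jones.HilbFunctor.isPositiveDefinite_coefficient _ _ _,
    Jones.vanishesAtInfinity_phi α h0 h1⟩, Jones.tendsto_phi, Jones.haagerupProperty_thompsonV⟩
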